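/- **Setting.** There are $n$ bidders and $k$ types of goods with supply $s$ each; bidder $i$ has value $v_{ij}\in[0,1]$ for good $j$. A matching is a map $\mu:[n]\to[k]\cup\{\perp\}$ that uses every good at most $s$ times; its welfare is $\sum_{i:\mu(i)\ne\perp}v_{i\mu(i)}$, and $\mathrm{OPT}=\mathrm{OPT}(v)$ is the largest welfare of a matching. A randomized map $\mathcal M$ from valuation profiles to $([k]\cup\{\perp\})^n$ is $\varepsilon$-joint differentially private if for every $i$, all profiles $v,v'$ that differ only in bidder $i$'s values, and every set $S$, $\Pr[\mathcal M(v)_{-i}\in S]\le e^{\varepsilon}\Pr[\mathcal M(v')_{-i}\in S]$. **Counters.** For a stream $\sigma_1,\dots,\sigma_N$, let $\ell$ be the number of binary digits of $N$. The reading at time $t$ of $\mathrm{Counter}(\varepsilon',N)$ is the sum of noisy partial sums of $\sigma$ over the dyadic blocks $(e-2^i,e]$, $e=\lfloor t/2^i\rfloor2^i$, that correspond to the nonzero binary digits $i$ of $t$ (these blocks partition $\{1,\dots,t\}$). Each partial sum is perturbed once, when its block is completed, by independent Laplace noise of scale $\ell/\varepsilon'$. The reading at time $0$ is $0$. **Algorithm.**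 Given $\alpha,\gamma\in(0,1)$, $\varepsilon>0$, $\lambda>0$ and a public number $O$ (the known value of $\mathrm{OPT}$), let $$T=\lceil 24/\alpha^2\rceil,\quad \varepsilon'=\frac{\varepsilon}{2T},\quad E=\frac{2\sqrt2}{\varepsilon'}\,\ell^{5/2}\ln\frac{4k}{\gamma},\quad m=2E+1,$$ with $\ell$ the number of binary digits of $nT$. Keep independent counters $\mathrm{Counter}(\varepsilon',nT)$ for each good $j$ (current reading $c_j$) and a further one, counter $0$. Start with $p_j=c_j=0$ and $\mu(i)=\emptyset$ for all $i,j$. Each of at most $T$ rounds is as follows. * *Propose.* Each bidder $i=1,\dots,n$ in turn: if $\mu(i)=\emptyset$, pick $j\in\arg\max_j(v_{ij}-p_j)$. If $v_{ij}-p_j\le0$, set $\mu(i)=\perp$ and do not bid. Otherwise set $\mu(i)=j$, save $d_i=c_j$, and bid on $j$. If $\mu(i)\ne\emptyset$, do not bid. In every case each good's counter is then fed $1$ if $i$ has just bid on that good and $0$ otherwise, the readings are updated, and for each $j$ with $c_j\ge(p_j/\alpha+1)(s-m)$ the price $p_j$ is raised by $\alpha$. (Ties in the $\arg\max$ are broken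 by any fixed rule that depends on the time step, the bidder, her own values and the current prices.) * *CountBids.* For each bidder $i$ in turn: if $\mu(i)$ is a good and $c_{\mu(i)}-d_i\ge s-m$, set $\mu(i)=\emptyset$; feed counter $0$ with $1$ if $i$ bid in this round and with $0$ otherwise. If counter $0$ increased in this round by less than $\frac{\alpha O}{2\lambda}-2E$, halt. At the end, bidders with $\mu(i)=\emptyset$ get $\perp$; output $\mu$. **Theorem.** There are absolute constants $A,K>0$ and $d\in\mathbb N$ such that for all $n,k,s$, all $\alpha,\gamma\in(0,1)$, $\varepsilon>0$, $\lambda>0$ and every tie-breaking rule as above: 1. for every public number $O$, the algorithm is $\varepsilon$-joint differentially private on valuation profiles with values in $[0,1]$; 2. if all values lie in $[0,1]$, every nonzero $v_{ij}$ is at least $\lambda$, $O=\mathrm{OPT}$, $\varepsilon\le1/\alpha^2$ (for example $\varepsilon\le1$), and, with $P=\bigl(1+\ln n+\ln k+\ln\frac1\alpha+\ln\frac1\gamma\bigr)^d$, $$s\ \ge\ \frac{K}{\alpha^3\varepsilon}\,P\qquad\text{and}\qquad \mathrm{OPT}\ \ge\ \frac{K\lambda}{\alpha^3\varepsilon}\,P,$$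 then with probability at least $1-\gamma$ the output is a matching (no good is used more than $s$ times) of welfare at least $\left(1-A\,\frac{\alpha}{\lambda}\right)\mathrm{OPT}$. -/

import Mathlib

open MeasureTheory

noncomputable section

namespace PMatch

/-! ### Matching markets: `n` bidders, `k` types of goods with supply `s` each.
An assignment is a map `Fin n → Option (Fin k)`; `none` is the dummy good `⊥`. -/

/-- The total value of an assignment; unmatched bidders contribute `0`. -/
def welfare {n k : ℕ} (v : Fin n → Fin k → ℝ) (μ : Fin n → Option (Fin k)) : ℝ :=
  ∑ i, (μ i).elim 0 (v i)

/-- An assignment is a matching if no type of good is used more often than its supply. -/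
def IsMatching {n k : ℕ} (s : ℕ) (μ : Fin n → Option (Fin k)) : Prop :=
  ∀ j : Fin k, (Finset.univ.filter (fun i => μ i = some j)).card ≤ s

/-- The weight of a maximum weight matching
(a maximum over a finite set that contains the empty matching). -/
def optWelfare {n k : ℕ} (s : ℕ) (v : Fin n → Fin k → ℝ) : ℝ :=
  sSup (welfare v '' {μ | IsMatching s μ})

/-! ### Joint differential privacy -/

/-- `M`, run on the random tape `ω ∼ P`, is `ε`-joint differentially private on databases with
entries in `C`: the joint output of all agents except `i` is `ε`-differentially private
in the data of agent `i`. -/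
def JointDP {n : ℕ} {V R Ω : Type} [MeasurableSpace Ω] (P : Measure Ω) (C : Set V)
    (M : (Fin n → V) → Ω → Fin n → R) (ε : ℝ) : Prop :=
  ∀ i : Fin n, ∀ D D' : Fin n → V, (∀ j, D j ∈ C) → (∀ j, D' j ∈ C) →
    (∀ j, j ≠ i → D j = D' j) →
    ∀ S : Set ({j : Fin n // j ≠ i} → R),
      P {ω | (fun j : {j : Fin n // j ≠ i} => M D ω j) ∈ S} ≤
        ENNReal.ofReal (Real.exp ε) *
          P {ω | (fun j : {j : Fin n // j ≠ i} => M D' ω j) ∈ S}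

/-! ### The Binary Mechanism (private streaming counter) -/

/-- The Laplace distribution on `ℝ` with scale `b`. -/
def laplace (b : ℝ) : Measure ℝ :=
  volume.withDensity (fun x => ENNReal.ofReal (1 / (2 * b) * Real.exp (-|x| / b)))

/-- The reading at time `t` of the binary counter fed with the stream `σ 1, σ 2, …`.
Write `t` in binary. Each nonzero bit `i` of `t` gives the dyadic block
`(e - 2 ^ i, e]` with `e = ⌊t / 2 ^ i⌋ * 2 ^ i`; these blocks partition `{1, …, t}`, and the
reading is the sum of the noisy partial sums over them. The partial sum over a block is perturbed
once, at the time `e` at which the block is completed (exactly one block is completed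
at each time), by the noise `η e`. -/
def counter (σ η : ℕ → ℝ) (t : ℕ) : ℝ :=
  ∑ i ∈ (Finset.range t.size).filter (fun i => t.testBit i = true),
    ((∑ u ∈ Finset.Ioc (t / 2 ^ i * 2 ^ i - 2 ^ i) (t / 2 ^ i * 2 ^ i), σ u)
      + η (t / 2 ^ i * 2 ^ i))

/-! ### Parameters of the algorithm -/

/-- The number of rounds, `24 / α²` rounded up. -/
def rounds (α : ℝ) : ℕ := ⌈24 / α ^ 2⌉₊

/-- The length of the stream of each counter: one step per bidder and round. -/
def horizon (n : ℕ) (α : ℝ) : ℕ := n * rounds α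

/-- The logarithm of the length of the streams, as the number of binary digits. -/
def logHorizon (n : ℕ) (α : ℝ) : ℝ := ((horizon n α).size : ℝ)

/-- The privacy parameter of each single counter. -/
def epsCounter (α ε : ℝ) : ℝ := ε / (2 * (rounds α : ℝ))

/-- The error bound `E` of the counters. -/
def errBound (n k : ℕ) (α ε γ : ℝ) : ℝ :=
  2 * Real.sqrt 2 / epsCounter α ε * logHorizon n α ^ (5 / 2 : ℝ) * Real.log (4 * k / γ)

/-- The reserved supply `m`. -/
def reserved (n k : ℕ) (α ε γ : ℝ) : ℝ := 2 * errBound n k α ε γ + 1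

/-- The random tape: one noise value for each counter (`some j` for good `j`, `none` for the
counter of the halting rule) and each time step `1, …, n * T` (stored at index `t - 1`). -/
abbrev Tape (n k : ℕ) (α : ℝ) : Type := Option (Fin k) × Fin (horizon n α) → ℝ

/-- All noise values are independent Laplace variables, of scale `log (n T) / ε'`. -/
def tapeMeasure (n k : ℕ) (α ε : ℝ) : Measure (Tape n k α) :=
  Measure.pi (fun _ => laplace (logHorizon n α / epsCounter α ε))

/-- The noise of counter `c`, as a function of the time step. -/
def noise {n k : ℕ} {α : ℝ} (ω : Tape n k α) (c : Option (Fin k)) (t : ℕ) : ℝ :=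
  if h : t - 1 < horizon n α then ω (c, ⟨t - 1, h⟩) else 0

/-! ### The algorithm -/

/-- The value of `μ(i)` during the run: not matched and still interested (`∅`),
matched to the dummy good (`⊥`), or matched to a good. -/
inductive Status (k : ℕ) : Type
  | unmatched : Status k
  | dummy : Status k
  | good (j : Fin k) : Status k

/-- A tie-breaking rule: `tie t i w p` is the good that bidder `i`, having values `w` for the goods,
picks at prices `p` in time step `t`. -/
abbrev TieRule (n k : ℕ) : Type := ℕ → Fin n → (Fin k → ℝ) → (Fin k → ℝ) → Fin k

/-- The picked good is always a favourite one at the given prices. -/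
def TieRule.Valid {n k : ℕ} (tie : TieRule n k) : Prop :=
  ∀ (t : ℕ) (i : Fin n) (w p : Fin k → ℝ) (j : Fin k),
    w j - p j ≤ w (tie t i w p) - p (tie t i w p)

/-- The state of a run of the algorithm. -/
structure State (n k : ℕ) : Type where
  /-- number of steps made so far by the counters of the goods -/
  clock : ℕ
  /-- the stream fed so far to the counter of each good -/
  stream : Fin k → ℕ → ℝ
  /-- the current reading `c_j` of the counter of each good -/
  count : Fin k → ℝ
  /-- the current price `p_j` of each good -/
  price : Fin k → ℝ
  /-- the current `μ(i)` of each bidder -/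
  asg : Fin n → Status k
  /-- the reading `d_i` saved by each bidder -/
  saved : Fin n → ℝ
  /-- whether the bidder has bid in the current round -/
  hasBid : Fin n → Bool
  /-- number of steps made so far by the counter of the halting rule -/
  clock₀ : ℕ
  /-- the stream fed so far to the counter of the halting rule -/
  stream₀ : ℕ → ℝ
  halted : Bool

def init (n k : ℕ) : State n k where
  clock := 0
  stream := fun _ _ => 0
  count := fun _ => 0
  price := fun _ => 0
  asg := fun _ => .unmatched
  saved := fun _ => 0
  hasBid := fun _ => false
  clock₀ := 0
  stream₀ := fun _ => 0
  halted := false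

/-- `Bid`: the bid vector is the unit vector `e_j` for `b = some j` and `0` for `b = none`;
`s'` is the supply `s - m` for sale and `η` the noise of the counters. -/
def bid {n k : ℕ} (α s' : ℝ) (η : Option (Fin k) → ℕ → ℝ) (b : Option (Fin k))
    (st : State n k) : State n k :=
  let t := st.clock + 1
  let stream' : Fin k → ℕ → ℝ := fun j =>
    Function.update (st.stream j) t (if b = some j then 1 else 0)
  let count' : Fin k → ℝ := fun j => counter (stream' j) (η (some j)) t
  { st with
    clock := t
    stream := stream'
    count := count'
    price := fun j =>
      if (st.price j / α + 1) * s' ≤ count' j then st.price j + α else st.price j }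

/-- `Propose` for the single bidder `i`. -/
def proposeOne {n k : ℕ} (α s' : ℝ) (η : Option (Fin k) → ℕ → ℝ) (tie : TieRule n k)
    (v : Fin n → Fin k → ℝ) (st : State n k) (i : Fin n) : State n k :=
  match st.asg i with
  | .unmatched =>
    let j := tie (st.clock + 1) i (v i) st.price
    if v i j - st.price j ≤ 0 then
      bid α s' η none
        { st with
          asg := Function.update st.asg i .dummy
          hasBid := Function.update st.hasBid i false }
    else
      bid α s' η (some j)
        { st with
          asg := Function.update st.asg i (.good j)
          saved := Function.update st.saved i (st.count j)
          hasBid := Function.update st.hasBid i true }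
  | _ => bid α s' η none { st with hasBid := Function.update st.hasBid i false }

/-- `CountBids` for the single bidder `i`: a bidder who has been outbid becomes unmatched, and the
counter of the halting rule is fed `1` if `i` bid this round and `0` otherwise. -/
def countOne {n k : ℕ} (s' : ℝ) (st : State n k) (i : Fin n) : State n k :=
  { st with
    asg := Function.update st.asg i
      (match st.asg i with
        | .good j => if s' ≤ st.count j - st.saved i then .unmatched else .good j
        | a => a)
    clock₀ := st.clock₀ + 1
    stream₀ := Function.update st.stream₀ (st.clock₀ + 1) (if st.hasBid i then 1 else 0) }

/-- One round: every bidder proposes, in the order of their indices; then `CountBids`. The algorithm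
halts if the counter of the halting rule has increased by less than `θ` in this round. -/
def round {n k : ℕ} (α s' θ : ℝ) (η : Option (Fin k) → ℕ → ℝ) (tie : TieRule n k)
    (v : Fin n → Fin k → ℝ) (st : State n k) : State n k :=
  if st.halted then st
  else
    let st₁ := (List.finRange n).foldl (proposeOne α s' η tie v) st
    let st₂ := (List.finRange n).foldl (countOne s') st₁
    { st₂ with
      halted := decide
        (counter st₂.stream₀ (η none) st₂.clock₀ - counter st.stream₀ (η none) st.clock₀ < θ) }

/-- The matching output by the algorithm when it is run on valuations `v` with random tape `ω`.
The number `opt` is the public value of the optimum used in the halting threshold.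
Bidders who are unmatched at the end are assigned the dummy good. -/
def output (n k s : ℕ) (α ε γ lam opt : ℝ) (tie : TieRule n k)
    (v : Fin n → Fin k → ℝ) (ω : Tape n k α) : Fin n → Option (Fin k) :=
  let s' : ℝ := s - reserved n k α ε γ
  let θ : ℝ := α * opt / (2 * lam) - 2 * errBound n k α ε γ
  let final := (round α s' θ (noise ω) tie v)^[rounds α] (init n k)
  fun i =>
    match final.asg i with
    | .good j => some j
    | _ => none

/-- The polylogarithmic factor `(1 + log n + log k + log (1/α) + log (1/γ)) ^ d`. -/
def polylog (d n k : ℕ) (α γ : ℝ) : ℝ :=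
  (1 + Real.log n + Real.log k + Real.log (1 / α) + Real.log (1 / γ)) ^ d

end PMatch

end

noncomputable section

namespace PMatch

/-! ### The binary counter -/

theorem div_pow_mul_pow_eq (t i : ℕ) :
    t / 2 ^ i * 2 ^ i =
      t / 2 ^ (i + 1) * 2 ^ (i + 1) + (if t.testBit i = true then 2 ^ i else 0) := by
  have h1 : t / 2 ^ (i + 1) = t / 2 ^ i / 2 := by rw [pow_succ, Nat.div_div_eq_div_mul]
  have h2 := Nat.div_add_mod (t / 2 ^ i) 2
  rw [Nat.testBit_eq_decide_div_mod_eq, h1]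
  simp only [decide_eq_true_eq]
  split_ifs with h
  · rw [h] at h2
    nth_rewrite 1 [← h2]
    ring
  · have h0 : t / 2 ^ i % 2 = 0 := by omega
    rw [h0] at h2
    nth_rewrite 1 [← h2]
    ring

/-- The sum of the noises that enter the reading at time `t`. -/
def noiseSum (η : ℕ → ℝ) (t : ℕ) : ℝ :=
  ∑ i ∈ (Finset.range t.size).filter (fun i => t.testBit i = true), η (t / 2 ^ i * 2 ^ i)

theorem counter_eq (σ η : ℕ → ℝ) (t : ℕ) :
    counter σ η t = ∑ u ∈ Finset.Ioc 0 t, σ u + noiseSum η t := by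
  rw [counter, Finset.sum_add_distrib, noiseSum]
  congr 1
  set g : ℕ → ℝ := fun i => ∑ u ∈ Finset.Ioc 0 (t / 2 ^ i * 2 ^ i), σ u with hg
  rw [Finset.sum_filter]
  have : ∀ i ∈ Finset.range t.size, (if t.testBit i = true then
      ∑ u ∈ Finset.Ioc (t / 2 ^ i * 2 ^ i - 2 ^ i) (t / 2 ^ i * 2 ^ i), σ u else 0)
      = g i - g (i + 1) := by
    intro i _
    have h := div_pow_mul_pow_eq t i
    split_ifs with hb
    · rw [if_pos hb] at h
      have h' : t / 2 ^ i * 2 ^ i - 2 ^ i = t / 2 ^ (i + 1) * 2 ^ (i + 1) := by omega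
      have hle : t / 2 ^ (i + 1) * 2 ^ (i + 1) ≤ t / 2 ^ i * 2 ^ i :=
        (Nat.le_add_right _ _).trans_eq h.symm
      rw [h', eq_sub_iff_add_eq, hg]
      simp only
      rw [add_comm, Finset.sum_Ioc_consecutive _ (Nat.zero_le _) hle]
    · rw [if_neg hb] at h
      simp only [hg]
      rw [h]; simp
  rw [Finset.sum_congr rfl this, Finset.sum_range_sub']
  have h0 : t / 2 ^ t.size = 0 := Nat.div_eq_of_lt (Nat.lt_size_self t)
  simp [hg, h0]

theorem counter_congr {σ σ' η η' : ℕ → ℝ} {t : ℕ} (h : ∀ u, u ≤ t → σ u = σ' u)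
    (h' : ∀ u, 0 < u → u ≤ t → η u = η' u) : counter σ η t = counter σ' η' t := by
  rw [counter_eq, counter_eq, noiseSum, noiseSum]
  congr 1
  · exact Finset.sum_congr rfl fun u hu => h u (Finset.mem_Ioc.1 hu).2
  · refine Finset.sum_congr rfl fun i hi => h' _ ?_ (Nat.div_mul_le_self _ _)
    have hb := (Finset.mem_filter.1 hi).2
    have h := div_pow_mul_pow_eq t i
    rw [if_pos hb] at h
    have : 0 < 2 ^ i := by positivity
    omega

/-- The length of the dyadic block that is completed at time `e`. -/
def blockLen (e : ℕ) : ℕ := 2 ^ padicValNat 2 e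

theorem blockLen_of_testBit {t i : ℕ} (h : t.testBit i = true) :
    blockLen (t / 2 ^ i * 2 ^ i) = 2 ^ i := by
  have hodd : t / 2 ^ i % 2 = 1 := by
    rw [Nat.testBit_eq_decide_div_mod_eq] at h
    simpa using h
  have h0 : t / 2 ^ i ≠ 0 := by intro h0; rw [h0] at hodd; simp at hodd
  rw [blockLen, padicValNat.mul h0 (by positivity), padicValNat.prime_pow,
    padicValNat.eq_zero_of_not_dvd (by omega), zero_add]

/-- Change of the noises that compensates the change `δ` of a stream. -/
def blockSum (δ : ℕ → ℝ) (e : ℕ) : ℝ := ∑ u ∈ Finset.Ioc (e - blockLen e) e, δ u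

theorem counter_shift (σ σ' η : ℕ → ℝ) (t : ℕ) :
    counter σ' (fun e => η e + blockSum (fun u => σ u - σ' u) e) t = counter σ η t := by
  unfold counter
  refine Finset.sum_congr rfl fun i hi => ?_
  simp only [blockSum]
  rw [blockLen_of_testBit (Finset.mem_filter.1 hi).2, Finset.sum_sub_distrib]
  ring

theorem blockLen_dvd (e : ℕ) : blockLen e ∣ e := pow_padicValNat_dvd

theorem card_blocks_le (N u : ℕ) :
    ((Finset.Icc 1 N).filter (fun e => u ∈ Finset.Ioc (e - blockLen e) e)).card ≤ N.size := by
  rw [← Finset.card_range N.size]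
  refine Finset.card_le_card_of_injOn (fun e => padicValNat 2 e) ?_ ?_
  · intro e he
    simp only [Finset.coe_filter, Finset.mem_Icc, Set.mem_ofPred_eq] at he
    simp only [Finset.coe_range, Set.mem_Iio]
    rw [Nat.lt_size]
    exact (Nat.le_of_dvd (by omega) (blockLen_dvd e)).trans he.1.2
  · intro e he e' he' h
    simp only [Finset.coe_filter, Finset.mem_Icc, Set.mem_ofPred_eq, Finset.mem_Ioc] at he he'
    obtain ⟨a, ha⟩ := blockLen_dvd e
    obtain ⟨b, hb⟩ := blockLen_dvd e'
    have hl : blockLen e' = blockLen e := by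
      simp only at h
      simp only [blockLen, h]
    rw [hl] at hb he'
    set l := blockLen e
    have hlpos : 0 < l := by simp [l, blockLen]
    have h1 : l * a < l * b + l := by
      rw [← ha, ← hb]; omega
    have h2 : l * b < l * a + l := by
      rw [← ha, ← hb]; omega
    have h3 : a < b + 1 := by
      by_contra hc
      have := Nat.mul_le_mul_left l (not_lt.1 hc); nlinarith
    have h4 : b < a + 1 := by
      by_contra hc
      have := Nat.mul_le_mul_left l (not_lt.1 hc); nlinarith
    rw [ha, hb, show a = b by omega]

theorem sum_abs_blockSum_le (δ : ℕ → ℝ) (N : ℕ) :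
    ∑ e ∈ Finset.Icc 1 N, |blockSum δ e| ≤ N.size * ∑ u ∈ Finset.Ioc 0 N, |δ u| := by
  calc ∑ e ∈ Finset.Icc 1 N, |blockSum δ e|
      ≤ ∑ e ∈ Finset.Icc 1 N, ∑ u ∈ Finset.Ioc 0 N,
          if u ∈ Finset.Ioc (e - blockLen e) e then |δ u| else 0 := by
        refine Finset.sum_le_sum fun e he => ?_
        refine (Finset.abs_sum_le_sum_abs _ _).trans (le_of_eq ?_)
        rw [← Finset.sum_filter]
        refine Finset.sum_congr ?_ fun _ _ => rfl
        ext u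
        simp only [Finset.mem_filter, Finset.mem_Ioc, Finset.mem_Icc] at he ⊢
        omega
    _ = ∑ u ∈ Finset.Ioc 0 N, ∑ e ∈ Finset.Icc 1 N,
          if u ∈ Finset.Ioc (e - blockLen e) e then |δ u| else 0 := Finset.sum_comm
    _ ≤ ∑ u ∈ Finset.Ioc 0 N, N.size * |δ u| := by
        refine Finset.sum_le_sum fun u _ => ?_
        rw [← Finset.sum_filter, Finset.sum_const, nsmul_eq_mul]
        exact mul_le_mul_of_nonneg_right (by exact_mod_cast card_blocks_le N u) (abs_nonneg _)
    _ = _ := by rw [Finset.mul_sum]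

/-! ### The Laplace distribution -/

theorem lintegral_exp_neg_mul_abs {a c : ℝ} (ha : 0 < a) (hc : 0 ≤ c) :
    ∫⁻ x : ℝ, ENNReal.ofReal (c * Real.exp (-(a * |x|))) = ENNReal.ofReal (2 * c / a) := by
  have hint : ∫ x : ℝ, Real.exp (-(a * |x|)) = 2 / a := by
    have := integral_comp_abs (f := fun x => Real.exp (-(a * x)))
    rw [this]
    have h2 := integral_exp_mul_Ioi (a := -a) (by linarith) 0
    simp only [neg_mul, mul_zero, Real.exp_zero] at h2
    rw [h2]; field_simp
  have hi : Integrable (fun x : ℝ => Real.exp (-(a * |x|))) := by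
    by_contra h
    rw [integral_undef h] at hint
    have : (0 : ℝ) < 2 / a := by positivity
    linarith
  rw [← ofReal_integral_eq_lintegral_ofReal (hi.const_mul c)
    (Filter.Eventually.of_forall fun x => by positivity), integral_const_mul, hint]
  congr 1; ring

theorem measurable_laplace_density (b : ℝ) :
    Measurable fun x : ℝ => ENNReal.ofReal (1 / (2 * b) * Real.exp (-|x| / b)) := by
  fun_prop

theorem isProbabilityMeasure_laplace {b : ℝ} (hb : 0 < b) : IsProbabilityMeasure (laplace b) := by
  constructor
  rw [laplace, withDensity_apply _ MeasurableSet.univ, Measure.restrict_univ]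
  have := lintegral_exp_neg_mul_abs (a := 1 / b) (c := 1 / (2 * b)) (by positivity) (by positivity)
  rw [show 2 * (1 / (2 * b)) / (1 / b) = 1 by field_simp, ENNReal.ofReal_one] at this
  rw [← this]
  refine lintegral_congr fun x => ?_
  congr 3; field_simp

theorem lintegral_exp_abs_laplace {b : ℝ} (hb : 0 < b) :
    ∫⁻ x, ENNReal.ofReal (Real.exp (1 / (2 * b) * |x|)) ∂laplace b = 2 := by
  rw [laplace, lintegral_withDensity_eq_lintegral_mul _ (measurable_laplace_density b)
    (by fun_prop)]
  have := lintegral_exp_neg_mul_abs (a := 1 / (2 * b)) (c := 1 / (2 * b)) (by positivity)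
    (by positivity)
  rw [show 2 * (1 / (2 * b)) / (1 / (2 * b)) = 2 by field_simp] at this
  rw [show (2 : ENNReal) = ENNReal.ofReal 2 by simp, ← this]
  refine lintegral_congr fun x => ?_
  simp only [Pi.mul_apply]
  rw [← ENNReal.ofReal_mul (by positivity), mul_assoc, ← Real.exp_add]
  congr 3; field_simp; ring

theorem laplace_map_add_le {b : ℝ} (hb : 0 < b) (h : ℝ) :
    (laplace b).map (fun x => x + h) ≤ ENNReal.ofReal (Real.exp (|h| / b)) • laplace b := by
  refine Measure.le_intro fun s hs _ => ?_
  rw [Measure.map_apply (by fun_prop) hs, Measure.smul_apply, smul_eq_mul, laplace,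
    withDensity_apply _ (measurable_add_const h hs), withDensity_apply _ hs,
    ← lintegral_indicator (measurable_add_const h hs), ← lintegral_indicator hs,
    ← lintegral_const_mul _ ((measurable_laplace_density b).indicator hs)]
  rw [← lintegral_sub_right_eq_self _ h]
  refine lintegral_mono fun x => ?_
  have hiff : x - h ∈ (fun x => x + h) ⁻¹' s ↔ x ∈ s := by simp
  by_cases hx : x ∈ s
  · rw [Set.indicator_of_mem hx, Set.indicator_of_mem (hiff.2 hx)]
    rw [← ENNReal.ofReal_mul (by positivity)]
    refine ENNReal.ofReal_le_ofReal ?_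
    rw [mul_left_comm, ← Real.exp_add]
    refine mul_le_mul_of_nonneg_left (Real.exp_le_exp.2 ?_) (by positivity)
    rw [← add_div]
    gcongr
    have := abs_sub_abs_le_abs_sub x (x - h)
    rw [sub_sub_cancel] at this
    linarith
  · rw [Set.indicator_of_notMem hx, Set.indicator_of_notMem (fun h => hx (hiff.1 h))]
    exact bot_le

theorem pi_le_smul_pi {ι : Type*} [Fintype ι] (μ ν : ι → Measure ℝ)
    [∀ i, SigmaFinite (μ i)] [∀ i, SigmaFinite (ν i)] (c : ι → ENNReal)
    (hc0 : ∀ i, c i ≠ 0) (hc : ∀ i, c i ≠ ⊤)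
    (h : ∀ i, ν i ≤ c i • μ i) : Measure.pi ν ≤ (∏ i, c i) • Measure.pi μ := by
  have hC0 : (∏ i, c i) ≠ 0 := Finset.prod_ne_zero_iff.2 fun i _ => hc0 i
  have hC : (∏ i, c i) ≠ ⊤ := ENNReal.prod_ne_top fun i _ => hc i
  have key : ((∏ i, c i)⁻¹ • Measure.pi ν).toOuterMeasure ≤
      OuterMeasure.pi fun i => (μ i).toOuterMeasure := by
    rw [OuterMeasure.le_pi]
    intro s _
    change ((∏ i, c i)⁻¹ • Measure.pi ν) (Set.pi Set.univ s) ≤ ∏ i, μ i (s i)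
    rw [Measure.smul_apply, smul_eq_mul, Measure.pi_pi, mul_comm, ← div_eq_mul_inv]
    refine ENNReal.div_le_of_le_mul ?_
    rw [mul_comm, ← Finset.prod_mul_distrib]
    exact Finset.prod_le_prod' fun i _ => by simpa using h i (s i)
  refine Measure.le_intro fun s hs _ => ?_
  have h1 := key s
  rw [Measure.smul_apply, smul_eq_mul]
  have h2 : Measure.pi μ s = OuterMeasure.pi (fun i => (μ i).toOuterMeasure) s := by
    rw [Measure.pi, toMeasure_apply _ _ hs]
  rw [h2, mul_comm]
  refine (ENNReal.div_le_iff hC0 hC).1 ?_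
  rw [div_eq_mul_inv, mul_comm]
  exact h1

theorem pi_laplace_preimage_add_le {ι : Type*} [Fintype ι] {b : ℝ} (hb : 0 < b) (h : ι → ℝ)
    {s : Set (ι → ℝ)} (hs : MeasurableSet s) :
    Measure.pi (fun _ : ι => laplace b) ((fun ω i => ω i + h i) ⁻¹' s) ≤
      ENNReal.ofReal (Real.exp ((∑ i, |h i|) / b)) * Measure.pi (fun _ : ι => laplace b) s := by
  have := isProbabilityMeasure_laplace hb
  have : ∀ i, IsProbabilityMeasure ((laplace b).map (fun x => x + h i)) := fun i =>
    Measure.isProbabilityMeasure_map (by fun_prop)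
  have h1 := pi_le_smul_pi (fun _ : ι => laplace b) (fun i => (laplace b).map (fun x => x + h i))
    (fun i => ENNReal.ofReal (Real.exp (|h i| / b)))
    (fun i => by simp [Real.exp_pos]) (fun i => by simp) (fun i => laplace_map_add_le hb (h i))
  have h2 : (Measure.pi (fun _ : ι => laplace b)).map (fun ω i => ω i + h i) =
      Measure.pi (fun i => (laplace b).map (fun x => x + h i)) :=
    Measure.pi_map_pi (f := fun i x => x + h i) (fun i => by fun_prop)
  rw [← h2, ← ENNReal.ofReal_prod_of_nonneg (fun i _ => (Real.exp_pos _).le), ← Real.exp_sum,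
    ← Finset.sum_div] at h1
  have h3 := h1 s
  rwa [Measure.map_apply (by fun_prop) hs] at h3

variable {n k : ℕ}

/-! ### Runs with arbitrary readings -/

/-- A reader maps a counter, the stream fed to it and a time to the reading. -/
abbrev Reader (k : ℕ) : Type := Option (Fin k) → (ℕ → ℝ) → ℕ → ℝ

/-- The binary counters with noise `η`. -/
def counterReader (η : Option (Fin k) → ℕ → ℝ) : Reader k := fun c σ t => counter σ (η c) t

/-- Readings that do not depend on the streams. -/
def oracleReader (ρ : Option (Fin k) → ℕ → ℝ) : Reader k := fun c _ t => ρ c t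

/-- `bid` with the readings given by `R`. -/
def readBid (α s' : ℝ) (R : Reader k) (b : Option (Fin k)) (st : State n k) : State n k :=
  let t := st.clock + 1
  let stream' : Fin k → ℕ → ℝ := fun j =>
    Function.update (st.stream j) t (if b = some j then 1 else 0)
  let count' : Fin k → ℝ := fun j => R (some j) (stream' j) t
  { st with
    clock := t
    stream := stream'
    count := count'
    price := fun j =>
      if (st.price j / α + 1) * s' ≤ count' j then st.price j + α else st.price j }

/-- The bid of bidder `i` in the next step. -/
def choice (tie : TieRule n k) (v : Fin n → Fin k → ℝ) (st : State n k) (i : Fin n) :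
    Option (Fin k) :=
  match st.asg i with
  | .unmatched =>
    if v i (tie (st.clock + 1) i (v i) st.price) - st.price (tie (st.clock + 1) i (v i) st.price) ≤ 0
    then none else some (tie (st.clock + 1) i (v i) st.price)
  | _ => none

/-- The status of a bidder after her decision `b`. -/
def nextStatus (b : Option (Fin k)) : Status k → Status k
  | .unmatched => b.elim .dummy .good
  | a => a

/-- The data of bidder `i` after her decision `b`. -/
def afterChoice (i : Fin n) (b : Option (Fin k)) (st : State n k) : State n k :=
  { st with
    asg := Function.update st.asg i (nextStatus b (st.asg i))
    saved := b.elim st.saved (fun j => Function.update st.saved i (st.count j))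
    hasBid := Function.update st.hasBid i b.isSome }

/-- `proposeOne` with the readings given by `R`. -/
def readPropose (α s' : ℝ) (R : Reader k) (tie : TieRule n k)
    (v : Fin n → Fin k → ℝ) (st : State n k) (i : Fin n) : State n k :=
  readBid α s' R (choice tie v st i) (afterChoice i (choice tie v st i) st)

/-- `round` with the readings given by `R`. -/
def readRound (α s' θ : ℝ) (R : Reader k) (tie : TieRule n k)
    (v : Fin n → Fin k → ℝ) (st : State n k) : State n k :=
  if st.halted then st
  else
    let st₁ := (List.finRange n).foldl (readPropose α s' R tie v) st
    let st₂ := (List.finRange n).foldl (countOne s') st₁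
    { st₂ with
      halted := decide (R none st₂.stream₀ st₂.clock₀ - R none st.stream₀ st.clock₀ < θ) }

/-- The state after `m` rounds. -/
def readRun (α s' θ : ℝ) (R : Reader k) (tie : TieRule n k)
    (v : Fin n → Fin k → ℝ) (m : ℕ) : State n k :=
  (readRound α s' θ R tie v)^[m] (init n k)

theorem proposeOne_eq (α s' : ℝ) (η : Option (Fin k) → ℕ → ℝ) (tie : TieRule n k)
    (v : Fin n → Fin k → ℝ) :
    proposeOne α s' η tie v = readPropose α s' (counterReader η) tie v := by
  funext st i
  unfold proposeOne readPropose choice afterChoice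
  rcases h : st.asg i with _ | _ | j
  · simp only
    split_ifs
    · rfl
    · rfl
  · have : Function.update st.asg i .dummy = st.asg := by rw [← h, Function.update_eq_self]
    simp only [nextStatus, this]
    rfl
  · have : Function.update st.asg i (.good j) = st.asg := by rw [← h, Function.update_eq_self]
    simp only [nextStatus, this]
    rfl

theorem round_eq (α s' θ : ℝ) (η : Option (Fin k) → ℕ → ℝ) (tie : TieRule n k)
    (v : Fin n → Fin k → ℝ) :
    round α s' θ η tie v = readRound α s' θ (counterReader η) tie v := by
  funext st
  unfold round readRound
  rw [proposeOne_eq]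
  rfl

theorem foldl_finRange_induction {β : Type*} (P : ℕ → β → Prop) (f : β → Fin n → β) (b : β)
    (h0 : P 0 b) (h : ∀ (i : Fin n) (b : β), P i b → P (i + 1) (f b i)) :
    P n ((List.finRange n).foldl f b) := by
  have key : ∀ m (hm : m ≤ n), P m (((List.finRange n).take m).foldl f b) := by
    intro m
    induction m with
    | zero => intro _; simpa using h0
    | succ m ih =>
      intro hm
      have hlt : m < (List.finRange n).length := by simpa using hm
      rw [List.take_succ_eq_append_getElem hlt, List.foldl_append]
      simpa using h ⟨m, hm⟩ _ (ih (by omega))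
  have := key n le_rfl
  rwa [List.take_of_length_le (by simp)] at this

/-- Simultaneous induction for two runs. -/
theorem foldl_finRange_induction₂ {β γ : Type*} (P : ℕ → β → γ → Prop) (f : β → Fin n → β)
    (g : γ → Fin n → γ) (b : β) (c : γ)
    (h0 : P 0 b c) (h : ∀ (i : Fin n) (b : β) (c : γ), P i b c → P (i + 1) (f b i) (g c i)) :
    P n ((List.finRange n).foldl f b) ((List.finRange n).foldl g c) := by
  have key : ∀ m (hm : m ≤ n), P m (((List.finRange n).take m).foldl f b)
      (((List.finRange n).take m).foldl g c) := by
    intro m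
    induction m with
    | zero => intro _; simpa using h0
    | succ m ih =>
      intro hm
      have hlt : m < (List.finRange n).length := by simpa using hm
      rw [List.take_succ_eq_append_getElem hlt, List.foldl_append, List.foldl_append]
      simpa using h ⟨m, hm⟩ _ _ (ih (by omega))
  have := key n le_rfl
  rwa [List.take_of_length_le (by simp)] at this

/-! ### Runs whose streams are known -/

/-- The streams fed so far are initial segments of the streams `F`, of length at most `N`. -/
structure Prefix (N : ℕ) (F : Option (Fin k) → ℕ → ℝ) (st : State n k) : Prop where
  clock_le : st.clock ≤ N
  clock₀_le : st.clock₀ ≤ N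
  stream : ∀ j u, u ≤ st.clock → st.stream j u = F (some j) u
  stream₀ : ∀ u, u ≤ st.clock₀ → st.stream₀ u = F none u

/-- Two readers agree up to time `N` on initial segments of the streams `F`. -/
def AgreeOn (N : ℕ) (F : Option (Fin k) → ℕ → ℝ) (R R' : Reader k) : Prop :=
  ∀ c σ t, t ≤ N → (∀ u, u ≤ t → σ u = F c u) → R c σ t = R' c σ t

theorem AgreeOn.symm {N : ℕ} {F : Option (Fin k) → ℕ → ℝ} {R R' : Reader k}
    (h : AgreeOn N F R R') : AgreeOn N F R' R := fun c σ t ht hσ => (h c σ t ht hσ).symm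

section

variable {N : ℕ} {F : Option (Fin k) → ℕ → ℝ} {R R' : Reader k} {α s' θ : ℝ} {tie : TieRule n k}
  {v : Fin n → Fin k → ℝ}

theorem Prefix.of_readPropose {st : State n k} {i : Fin n}
    (h : Prefix N F (readPropose α s' R tie v st i)) : Prefix N F st := by
  obtain ⟨h1, h2, h3, h4⟩ := h
  refine ⟨(Nat.le_succ _).trans h1, h2, fun j u hu => ?_, h4⟩
  rw [← h3 j u (hu.trans (Nat.le_succ _))]
  have : u ≠ st.clock + 1 := by omega
  simp [readPropose, readBid, afterChoice, Function.update_of_ne this]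

theorem readPropose_congr (hR : AgreeOn N F R R') {st : State n k} {i : Fin n}
    (h : Prefix N F (readPropose α s' R tie v st i)) :
    readPropose α s' R tie v st i = readPropose α s' R' tie v st i := by
  obtain ⟨h1, -, h3, -⟩ := h
  have key : ∀ j, R (some j) (Function.update (st.stream j) (st.clock + 1)
      (if choice tie v st i = some j then 1 else 0)) (st.clock + 1) =
      R' (some j) (Function.update (st.stream j) (st.clock + 1)
      (if choice tie v st i = some j then 1 else 0)) (st.clock + 1) := fun j =>
    hR (some j) _ _ h1 (fun u hu => h3 j u hu)
  simp only [readPropose, readBid, afterChoice, key]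
  rfl

theorem Prefix.of_countOne {st : State n k} {i : Fin n}
    (h : Prefix N F (countOne s' st i)) : Prefix N F st := by
  obtain ⟨h1, h2, h3, h4⟩ := h
  refine ⟨h1, (Nat.le_succ _).trans h2, h3, fun u hu => ?_⟩
  rw [← h4 u (hu.trans (Nat.le_succ _))]
  have : u ≠ st.clock₀ + 1 := by omega
  simp [countOne, Function.update_of_ne this]

theorem Prefix.of_foldl {f : State n k → Fin n → State n k}
    (hf : ∀ st i, Prefix N F (f st i) → Prefix N F st) (l : List (Fin n)) (st : State n k)
    (h : Prefix N F (l.foldl f st)) : Prefix N F st := by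
  induction l generalizing st with
  | nil => exact h
  | cons a l ih => exact hf _ _ (ih _ h)

theorem foldl_congr_of_prefix {f g : State n k → Fin n → State n k}
    (hf : ∀ st i, Prefix N F (f st i) → Prefix N F st)
    (hfg : ∀ st i, Prefix N F (f st i) → f st i = g st i) (l : List (Fin n)) (st : State n k)
    (h : Prefix N F (l.foldl f st)) : l.foldl f st = l.foldl g st := by
  induction l generalizing st with
  | nil => rfl
  | cons a l ih =>
    simp only [List.foldl_cons] at h ⊢
    rw [← hfg st a (Prefix.of_foldl hf l _ h)]
    exact ih _ h

theorem Prefix.of_readRound {st : State n k}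
    (h : Prefix N F (readRound α s' θ R tie v st)) : Prefix N F st := by
  unfold readRound at h
  split_ifs at h
  · exact h
  · have h' : Prefix N F ((List.finRange n).foldl (countOne s')
        ((List.finRange n).foldl (readPropose α s' R tie v) st)) := ⟨h.1, h.2, h.3, h.4⟩
    exact Prefix.of_foldl (fun _ _ => Prefix.of_readPropose) _ _
      (Prefix.of_foldl (fun _ _ => Prefix.of_countOne) _ _ h')

theorem readRound_congr (hR : AgreeOn N F R R') {st : State n k}
    (h : Prefix N F (readRound α s' θ R tie v st)) :
    readRound α s' θ R tie v st = readRound α s' θ R' tie v st := by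
  have h0 := h.of_readRound
  unfold readRound at h ⊢
  split_ifs at h ⊢
  · rfl
  · have h' : Prefix N F ((List.finRange n).foldl (countOne s')
        ((List.finRange n).foldl (readPropose α s' R tie v) st)) := ⟨h.1, h.2, h.3, h.4⟩
    have h1 := foldl_congr_of_prefix (f := readPropose α s' R tie v)
      (g := readPropose α s' R' tie v) (fun _ _ => Prefix.of_readPropose)
      (fun _ _ => readPropose_congr hR) _ _ (Prefix.of_foldl (fun _ _ => Prefix.of_countOne) _ _ h')
    rw [h1] at h' ⊢
    dsimp only
    rw [hR none _ _ h'.clock₀_le h'.stream₀, hR none _ _ h0.clock₀_le h0.stream₀]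

theorem readRun_congr (hR : AgreeOn N F R R') {m : ℕ}
    (h : Prefix N F (readRun α s' θ R tie v m)) :
    readRun α s' θ R tie v m = readRun α s' θ R' tie v m := by
  induction m with
  | zero => rfl
  | succ m ih =>
    unfold readRun at h ih ⊢
    rw [Function.iterate_succ_apply'] at h ⊢
    rw [Function.iterate_succ_apply', ← ih h.of_readRound]
    exact readRound_congr hR h

end

/-! ### Clocks and streams -/

/-- The streams consist of zeros and ones, and are zero outside `{1, …, clock}`. -/
structure Valid01 (st : State n k) : Prop where
  stream : ∀ j u, st.stream j u = 0 ∨ st.stream j u = 1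
  stream₀ : ∀ u, st.stream₀ u = 0 ∨ st.stream₀ u = 1
  after : ∀ j u, st.clock < u → st.stream j u = 0
  after₀ : ∀ u, st.clock₀ < u → st.stream₀ u = 0

section

variable {R : Reader k} {α s' θ : ℝ} {tie : TieRule n k} {v : Fin n → Fin k → ℝ}

theorem Valid01.readPropose {st : State n k} (h : Valid01 st) (i : Fin n) :
    Valid01 (readPropose α s' R tie v st i) := by
  obtain ⟨h1, h2, h3, h4⟩ := h
  refine ⟨fun j u => ?_, h2, fun j u hu => ?_, h4⟩
  · by_cases hu : u = st.clock + 1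
    · subst hu
      simp only [PMatch.readPropose, readBid, afterChoice, Function.update_self]
      split_ifs <;> simp
    · simpa [PMatch.readPropose, readBid, afterChoice, Function.update_of_ne hu] using h1 j u
  · replace hu : st.clock + 1 < u := hu
    simpa [PMatch.readPropose, readBid, afterChoice, Function.update_of_ne hu.ne'] using
      h3 j u (by omega)

theorem Valid01.countOne {st : State n k} (h : Valid01 st) (i : Fin n) :
    Valid01 (countOne s' st i) := by
  obtain ⟨h1, h2, h3, h4⟩ := h
  refine ⟨h1, fun u => ?_, h3, fun u hu => ?_⟩
  · by_cases hu : u = st.clock₀ + 1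
    · subst hu
      simp only [PMatch.countOne, Function.update_self]
      split_ifs <;> simp
    · simpa [PMatch.countOne, Function.update_of_ne hu] using h2 u
  · replace hu : st.clock₀ + 1 < u := hu
    simpa [PMatch.countOne, Function.update_of_ne hu.ne'] using h4 u (by omega)

theorem valid01_readRound {st : State n k} {m : ℕ}
    (h : Valid01 st ∧ st.clock ≤ n * m ∧ st.clock₀ ≤ n * m) :
    Valid01 (readRound α s' θ R tie v st) ∧ (readRound α s' θ R tie v st).clock ≤ n * (m + 1) ∧
      (readRound α s' θ R tie v st).clock₀ ≤ n * (m + 1) := by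
  unfold readRound
  split_ifs
  · exact ⟨h.1, h.2.1.trans (Nat.mul_le_mul_left _ (Nat.le_succ _)),
      h.2.2.trans (Nat.mul_le_mul_left _ (Nat.le_succ _))⟩
  · have h1 := foldl_finRange_induction (fun a st => Valid01 st ∧ st.clock ≤ n * m + a ∧
      st.clock₀ ≤ n * m) (readPropose α s' R tie v) st h
      (fun i st hst => ⟨hst.1.readPropose i, Nat.add_le_add_right hst.2.1 1, hst.2.2⟩)
    have h2 := foldl_finRange_induction (fun a st => Valid01 st ∧ st.clock ≤ n * m + n ∧
      st.clock₀ ≤ n * m + a) (countOne s') _ h1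
      (fun i st hst => ⟨hst.1.countOne i, hst.2.1, Nat.add_le_add_right hst.2.2 1⟩)
    obtain ⟨h3, h4, h5⟩ := h2
    exact ⟨⟨h3.1, h3.2, h3.3, h3.4⟩, h4, h5⟩

theorem valid01_init : Valid01 (init n k) :=
  ⟨fun _ _ => Or.inl rfl, fun _ => Or.inl rfl, fun _ _ _ => rfl, fun _ _ => rfl⟩

theorem valid01_readRun (m : ℕ) :
    Valid01 (readRun α s' θ R tie v m) ∧ (readRun α s' θ R tie v m).clock ≤ n * m ∧
      (readRun α s' θ R tie v m).clock₀ ≤ n * m := by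
  induction m with
  | zero => exact ⟨valid01_init, le_rfl, le_rfl⟩
  | succ m ih =>
    unfold readRun at ih ⊢
    rw [Function.iterate_succ_apply']
    exact valid01_readRound ih

end

/-! ### Runs with the same readings on neighbouring profiles -/

/-- Two states that differ at most in the private data of bidder `i` and in the streams. -/
structure Coupled (i : Fin n) (st st' : State n k) : Prop where
  clock : st.clock = st'.clock
  count : st.count = st'.count
  price : st.price = st'.price
  clock₀ : st.clock₀ = st'.clock₀
  halted : st.halted = st'.halted
  asg : ∀ a, a ≠ i → st.asg a = st'.asg a
  saved : ∀ a, a ≠ i → st.saved a = st'.saved a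
  hasBid : ∀ a, a ≠ i → st.hasBid a = st'.hasBid a

/-- The `ℓ¹`-distance of the streams of two states. -/
def streamDist (st st' : State n k) : ℝ :=
  ∑ j, ∑ u ∈ Finset.Ioc 0 st.clock, |st.stream j u - st'.stream j u| +
    ∑ u ∈ Finset.Ioc 0 st.clock₀, |st.stream₀ u - st'.stream₀ u|

/-- The difference of the entries that bidder `i` is going to feed to the halting counter. -/
def bidDist (i : Fin n) (st st' : State n k) : ℝ :=
  |(if st.hasBid i then 1 else 0 : ℝ) - (if st'.hasBid i then 1 else 0)|

theorem sum_abs_unit_sub_unit (b b' : Option (Fin k)) :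
    ∑ j, |(if b = some j then 1 else 0 : ℝ) - (if b' = some j then 1 else 0)| +
      |(if b.isSome then 1 else 0 : ℝ) - (if b'.isSome then 1 else 0)| ≤ 2 := by
  have h : ∑ j, |(if b = some j then 1 else 0 : ℝ) - (if b' = some j then 1 else 0)| ≤
      (if b.isSome then 1 else 0) + (if b'.isSome then 1 else 0) := by
    have hs : ∀ c : Option (Fin k), ∑ j, (if c = some j then 1 else 0 : ℝ) =
        if c.isSome then 1 else 0 := by
      intro c
      cases c <;> simp
    rw [← hs b, ← hs b', ← Finset.sum_add_distrib]
    refine Finset.sum_le_sum fun j _ => ?_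
    split_ifs <;> norm_num
  rcases b with _ | b <;> rcases b' with _ | b' <;> simp at h ⊢ <;> linarith

section

variable {α s' θ : ℝ} {ρ : Option (Fin k) → ℕ → ℝ} {tie : TieRule n k}
  {v v' : Fin n → Fin k → ℝ} {i : Fin n} {st st' : State n k}

theorem Coupled.choice_eq (h : Coupled i st st') (hv : ∀ a, a ≠ i → v a = v' a) {a : Fin n}
    (ha : a ≠ i) : choice tie v st a = choice tie v' st' a := by
  simp only [choice, h.asg a ha, h.clock, h.price, hv a ha]

theorem Coupled.readPropose (h : Coupled i st st') (hv : ∀ a, a ≠ i → v a = v' a) (a : Fin n) :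
    Coupled i (readPropose α s' (oracleReader ρ) tie v st a)
      (readPropose α s' (oracleReader ρ) tie v' st' a) := by
  have hcount : (PMatch.readPropose α s' (oracleReader ρ) tie v st a).count =
      (PMatch.readPropose α s' (oracleReader ρ) tie v' st' a).count := by
    simp only [PMatch.readPropose, readBid, afterChoice, oracleReader, h.clock]
  refine ⟨congrArg (· + 1) h.clock, hcount, ?_, h.clock₀, h.halted, fun c hc => ?_,
    fun c hc => ?_, fun c hc => ?_⟩
  · simp only [PMatch.readPropose, readBid, afterChoice, oracleReader, h.clock, h.price]
    rfl
  · by_cases hca : c = a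
    · subst hca
      simp only [PMatch.readPropose, readBid, afterChoice, h.choice_eq hv hc, h.asg c hc,
        Function.update_self]
    · have h1 : ∀ (w : Fin n → Fin k → ℝ) (s : State n k),
          (PMatch.readPropose α s' (oracleReader ρ) tie w s a).asg c = s.asg c := by
        intro w s
        simp only [PMatch.readPropose, readBid, afterChoice, Function.update_of_ne hca]
      rw [h1, h1, h.asg c hc]
  · by_cases hca : c = a
    · subst hca
      simp only [PMatch.readPropose, readBid, afterChoice, h.choice_eq hv hc]
      cases choice tie v' st' c <;> simp [h.saved c hc, h.count]
    · have h1 : ∀ (w : Fin n → Fin k → ℝ) (s : State n k),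
          (PMatch.readPropose α s' (oracleReader ρ) tie w s a).saved c = s.saved c := by
        intro w s
        simp only [PMatch.readPropose, readBid, afterChoice]
        cases choice tie w s a <;> simp [Function.update_of_ne hca]
      rw [h1, h1, h.saved c hc]
  · by_cases hca : c = a
    · subst hca
      simp only [PMatch.readPropose, readBid, afterChoice, h.choice_eq hv hc, Function.update_self]
    · simp only [PMatch.readPropose, readBid, afterChoice, Function.update_of_ne hca, h.hasBid c hc]

theorem sum_abs_update_sub (f g : ℕ → ℝ) (t : ℕ) (x y : ℝ) :
    ∑ u ∈ Finset.Ioc 0 (t + 1), |Function.update f (t + 1) x u - Function.update g (t + 1) y u| =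
      ∑ u ∈ Finset.Ioc 0 t, |f u - g u| + |x - y| := by
  rw [Finset.sum_Ioc_succ_top (Nat.zero_le _)]
  simp only [Function.update_self]
  congr 1
  refine Finset.sum_congr rfl fun u hu => ?_
  have : u ≠ t + 1 := by have := (Finset.mem_Ioc.1 hu).2; omega
  rw [Function.update_of_ne this, Function.update_of_ne this]

theorem streamDist_readPropose (h : Coupled i st st') (a : Fin n) :
    streamDist (readPropose α s' (oracleReader ρ) tie v st a)
      (readPropose α s' (oracleReader ρ) tie v' st' a) = streamDist st st' +
      ∑ j, |(if choice tie v st a = some j then 1 else 0 : ℝ) -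
        (if choice tie v' st' a = some j then 1 else 0)| := by
  simp only [streamDist, readPropose, readBid, afterChoice, ← h.clock, sum_abs_update_sub,
    Finset.sum_add_distrib]
  ring

theorem bidDist_readPropose_self : bidDist i (readPropose α s' (oracleReader ρ) tie v st i)
      (readPropose α s' (oracleReader ρ) tie v' st' i) =
      |(if (choice tie v st i).isSome then 1 else 0 : ℝ) -
        (if (choice tie v' st' i).isSome then 1 else 0)| := by
  simp only [bidDist, readPropose, readBid, afterChoice, Function.update_self]

theorem bidDist_readPropose_of_ne {a : Fin n} (ha : a ≠ i) :
    bidDist i (readPropose α s' (oracleReader ρ) tie v st a)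
      (readPropose α s' (oracleReader ρ) tie v' st' a) = bidDist i st st' := by
  simp only [bidDist, readPropose, readBid, afterChoice, Function.update_of_ne ha.symm]

theorem Coupled.countOne (h : Coupled i st st') (a : Fin n) :
    Coupled i (countOne s' st a) (countOne s' st' a) := by
  refine ⟨h.clock, h.count, h.price, congrArg (· + 1) h.clock₀, h.halted, fun c hc => ?_,
    h.saved, h.hasBid⟩
  by_cases hca : c = a
  · subst hca
    simp only [PMatch.countOne, Function.update_self, h.asg c hc, h.saved c hc, h.count]
  · simp only [PMatch.countOne, Function.update_of_ne hca, h.asg c hc]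

theorem streamDist_countOne (h : Coupled i st st') (a : Fin n) :
    streamDist (countOne s' st a) (countOne s' st' a) = streamDist st st' + bidDist a st st' := by
  simp only [streamDist, countOne, ← h.clock₀, sum_abs_update_sub, bidDist]
  ring

theorem Coupled.bidDist_eq_zero (h : Coupled i st st') {a : Fin n} (ha : a ≠ i) :
    bidDist a st st' = 0 := by
  simp [bidDist, h.hasBid a ha]

theorem Coupled.readRound (h : Coupled i st st') (hv : ∀ a, a ≠ i → v a = v' a) :
    Coupled i (readRound α s' θ (oracleReader ρ) tie v st)
      (readRound α s' θ (oracleReader ρ) tie v' st') ∧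
    streamDist (PMatch.readRound α s' θ (oracleReader ρ) tie v st)
      (PMatch.readRound α s' θ (oracleReader ρ) tie v' st') ≤ streamDist st st' + 2 := by
  unfold PMatch.readRound
  by_cases hh : st.halted = true
  · rw [if_pos hh, if_pos (h.halted ▸ hh)]
    exact ⟨h, by linarith⟩
  rw [if_neg hh, if_neg (h.halted ▸ hh)]
  have h1 := foldl_finRange_induction₂ (fun a b b' => Coupled i b b' ∧
      if (i : ℕ) < a then streamDist b b' + bidDist i b b' ≤ streamDist st st' + 2
      else streamDist b b' ≤ streamDist st st')
    (PMatch.readPropose α s' (oracleReader ρ) tie v)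
    (PMatch.readPropose α s' (oracleReader ρ) tie v') st st' ⟨h, by simp⟩ (by
      rintro a b b' ⟨hb, hd⟩
      refine ⟨hb.readPropose hv a, ?_⟩
      rw [streamDist_readPropose hb]
      by_cases ha : a = i
      · subst ha
        rw [if_neg (lt_irrefl _)] at hd
        rw [if_pos (Nat.lt_succ_self _), bidDist_readPropose_self]
        have := sum_abs_unit_sub_unit (choice tie v b a) (choice tie v' b' a)
        linarith
      · have ha' : (a : ℕ) ≠ i := fun hc => ha (Fin.ext hc)
        rw [hb.choice_eq hv ha, bidDist_readPropose_of_ne ha]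
        simp only [sub_self, abs_zero, Finset.sum_const_zero, add_zero]
        by_cases hlt : (i : ℕ) < a
        · rw [if_pos hlt] at hd
          rwa [if_pos (by omega)]
        · rw [if_neg hlt] at hd
          rwa [if_neg (by omega)])
  obtain ⟨h1, h1d⟩ := h1
  rw [if_pos i.2] at h1d
  have h2 := foldl_finRange_induction₂ (fun a b b' => Coupled i b b' ∧
      streamDist b b' + (if a ≤ (i : ℕ) then bidDist i b b' else 0) ≤ streamDist st st' + 2)
    (PMatch.countOne s') (PMatch.countOne s') _ _ ⟨h1, by simpa using h1d⟩ (by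
      rintro a b b' ⟨hb, hd⟩
      refine ⟨hb.countOne a, ?_⟩
      rw [streamDist_countOne hb]
      have hbd : bidDist i (PMatch.countOne s' b a) (PMatch.countOne s' b' a) = bidDist i b b' := rfl
      rw [hbd]
      by_cases ha : a = i
      · subst ha
        rw [if_pos le_rfl] at hd
        rw [if_neg (by omega)]
        linarith
      · have ha' : (a : ℕ) ≠ i := fun hc => ha (Fin.ext hc)
        rw [hb.bidDist_eq_zero ha, add_zero]
        have : ((a : ℕ) + 1 ≤ i) ↔ (a : ℕ) ≤ i := by omega
        simpa only [this] using hd)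
  obtain ⟨h2, h2d⟩ := h2
  rw [if_neg (by have := i.2; omega), add_zero] at h2d
  refine ⟨⟨h2.1, h2.2, h2.3, h2.4, ?_, h2.6, h2.7, h2.8⟩, h2d⟩
  simp only [oracleReader, h2.clock₀, h.clock₀]
  rfl

theorem coupled_readRun (hv : ∀ a, a ≠ i → v a = v' a) (m : ℕ) :
    Coupled i (readRun α s' θ (oracleReader ρ) tie v m)
      (readRun α s' θ (oracleReader ρ) tie v' m) ∧
    streamDist (readRun α s' θ (oracleReader ρ) tie v m)
      (readRun α s' θ (oracleReader ρ) tie v' m) ≤ 2 * m := by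
  induction m with
  | zero =>
    refine ⟨⟨rfl, rfl, rfl, rfl, rfl, fun _ _ => rfl, fun _ _ => rfl, fun _ _ => rfl⟩, ?_⟩
    simp [readRun, streamDist]
  | succ m ih =>
    unfold readRun at ih ⊢
    rw [Function.iterate_succ_apply', Function.iterate_succ_apply']
    have := ih.1.readRound (α := α) (s' := s') (θ := θ) (ρ := ρ) (tie := tie) hv
    refine ⟨this.1, this.2.trans ?_⟩
    push_cast
    linarith [ih.2]

end

/-! ### Measurability of runs -/

/-- The part of a state that takes only countably many values. -/
def discretePart (st : State n k) : State n k :=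
  { st with
    count := fun _ => 0
    saved := fun _ => 0 }

/-- The state `x` with new real-valued data. -/
def withReals (x : State n k) (c : Fin k → ℝ) (d : Fin n → ℝ) : State n k :=
  { x with
    count := c
    saved := d }

/-- Random states whose real-valued data are measurable, and whose remaining data are
countably-valued and measurable. -/
structure MeasurableState {Ω : Type*} [MeasurableSpace Ω] (f : Ω → State n k) : Prop where
  countable : (Set.range fun ω => discretePart (f ω)).Countable
  fiber : ∀ x, MeasurableSet {ω | discretePart (f ω) = x}
  count : ∀ j, Measurable fun ω => (f ω).count j
  saved : ∀ i, Measurable fun ω => (f ω).saved i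

section

variable {Ω : Type*} [MeasurableSpace Ω] {f : Ω → State n k}

theorem measurable_of_cover {ι : Type*} [Countable ι] {S : ι → Set Ω} (hS : ∀ x, MeasurableSet (S x))
    (hcov : ∀ ω, ∃ x, ω ∈ S x) {f : Ω → ℝ} {g : ι → Ω → ℝ} (hg : ∀ x, Measurable (g x))
    (hfg : ∀ x, ∀ ω ∈ S x, f ω = g x ω) : Measurable f := by
  intro B hB
  have : f ⁻¹' B = ⋃ x, S x ∩ g x ⁻¹' B := by
    ext ω
    simp only [Set.mem_preimage, Set.mem_iUnion, Set.mem_inter_iff]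
    constructor
    · intro h
      obtain ⟨x, hx⟩ := hcov ω
      exact ⟨x, hx, hfg x ω hx ▸ h⟩
    · rintro ⟨x, hx, h⟩
      rwa [hfg x ω hx]
  rw [this]
  exact MeasurableSet.iUnion fun x => (hS x).inter (hg x hB)

theorem MeasurableState.of_cover {ι : Type*} [Countable ι] (S : ι → Set Ω)
    (hS : ∀ x, MeasurableSet (S x)) (hcov : ∀ ω, ∃ x, ω ∈ S x) (g : ι → Ω → State n k)
    (hg : ∀ x, MeasurableState (g x)) (hfg : ∀ x, ∀ ω ∈ S x, f ω = g x ω) :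
    MeasurableState f := by
  refine ⟨?_, fun y => ?_, fun j => measurable_of_cover hS hcov (fun x => (hg x).count j)
    (fun x ω h => by rw [hfg x ω h]), fun i => measurable_of_cover hS hcov
    (fun x => (hg x).saved i) (fun x ω h => by rw [hfg x ω h])⟩
  · refine (Set.countable_iUnion fun x => (hg x).countable).mono ?_
    rintro _ ⟨ω, rfl⟩
    obtain ⟨x, hx⟩ := hcov ω
    exact Set.mem_iUnion.2 ⟨x, ω, by simp only [hfg x ω hx]⟩
  · have : {ω | discretePart (f ω) = y} = ⋃ x, S x ∩ {ω | discretePart (g x ω) = y} := by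
      ext ω
      simp only [Set.mem_ofPred_eq, Set.mem_iUnion, Set.mem_inter_iff]
      constructor
      · intro h
        obtain ⟨x, hx⟩ := hcov ω
        exact ⟨x, hx, hfg x ω hx ▸ h⟩
      · rintro ⟨x, hx, h⟩
        rwa [hfg x ω hx]
    rw [this]
    exact MeasurableSet.iUnion fun x => (hS x).inter ((hg x).fiber y)

theorem measurableState_withReals (x : State n k) {c : Ω → Fin k → ℝ} {d : Ω → Fin n → ℝ}
    (hc : ∀ j, Measurable fun ω => c ω j) (hd : ∀ i, Measurable fun ω => d ω i) :
    MeasurableState fun ω => withReals x (c ω) (d ω) := by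
  have h : ∀ ω, discretePart (withReals x (c ω) (d ω)) = discretePart x := fun _ => rfl
  refine ⟨?_, fun y => ?_, hc, hd⟩
  · simp only [h]
    exact (Set.countable_singleton (discretePart x)).mono (by rintro _ ⟨ω, rfl⟩; rfl)
  · simp only [h]
    exact MeasurableSet.const _

theorem MeasurableState.bind (hf : MeasurableState f) (Φ : Ω → State n k → State n k)
    (h : ∀ x (c : Ω → Fin k → ℝ) (d : Ω → Fin n → ℝ), (∀ j, Measurable fun ω => c ω j) →
      (∀ i, Measurable fun ω => d ω i) → MeasurableState fun ω => Φ ω (withReals x (c ω) (d ω))) :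
    MeasurableState fun ω => Φ ω (f ω) := by
  have := hf.countable.to_subtype
  refine MeasurableState.of_cover
    (fun x : Set.range (fun ω => discretePart (f ω)) => {ω | discretePart (f ω) = x})
    (fun x => hf.fiber x) (fun ω => ⟨⟨_, ω, rfl⟩, rfl⟩)
    (fun x ω => Φ ω (withReals x (f ω).count (f ω).saved))
    (fun x => h x _ _ hf.count hf.saved) ?_
  intro x ω hω
  have : withReals (discretePart (f ω)) (f ω).count (f ω).saved = f ω := rfl
  rw [← this, hω]
  rfl

variable {α s' θ : ℝ} {ρ : Ω → Option (Fin k) → ℕ → ℝ} {tie : TieRule n k}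
  {v : Fin n → Fin k → ℝ}

theorem MeasurableState.readPropose (hρ : ∀ c t, Measurable fun ω => ρ ω c t)
    (hf : MeasurableState f) (a : Fin n) :
    MeasurableState fun ω => readPropose α s' (oracleReader (ρ ω)) tie v (f ω) a := by
  refine hf.bind (fun ω st => PMatch.readPropose α s' (oracleReader (ρ ω)) tie v st a) ?_
  intro x c d hc hd
  set b := choice tie v x a with hb
  refine MeasurableState.of_cover (fun β : Fin k → Bool =>
    {ω | ∀ j, (x.price j / α + 1) * s' ≤ ρ ω (some j) (x.clock + 1) ↔ β j = true}) ?_ ?_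
    (fun β ω => withReals
      { (PMatch.readPropose α s' (oracleReader (ρ ω)) tie v x a) with
        count := fun _ => 0
        saved := fun _ => 0
        price := fun j => if β j = true then x.price j + α else x.price j }
      (fun j => ρ ω (some j) (x.clock + 1))
      (b.elim (d ω) (fun j => Function.update (d ω) a (c ω j)))) ?_ ?_
  · intro β
    refine MeasurableSet.iInter (f := fun j => {ω | (x.price j / α + 1) * s' ≤
      ρ ω (some j) (x.clock + 1) ↔ β j = true}) (fun j => ?_) |>.congr (by ext ω; simp)
    cases β j
    · simpa using measurableSet_lt (hρ _ _) measurable_const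
    · simpa using measurableSet_le measurable_const (hρ _ _)
  · intro ω
    exact ⟨fun j => decide ((x.price j / α + 1) * s' ≤ ρ ω (some j) (x.clock + 1)), by simp⟩
  · intro β
    refine measurableState_withReals
      { (PMatch.readPropose α s' (oracleReader fun _ _ => 0) tie v x a) with
        count := fun _ => 0
        saved := fun _ => 0
        price := fun j => if β j = true then x.price j + α else x.price j }
      (fun j => hρ _ _) (fun i => ?_)
    cases b with
    | none => exact hd i
    | some j =>
      by_cases hi : i = a
      · subst hi; simpa using hc j
      · simpa [Function.update_of_ne hi] using hd i
  · intro β ω hω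
    have h1 : (fun j => if (x.price j / α + 1) * s' ≤ ρ ω (some j) (x.clock + 1) then x.price j + α
        else x.price j) = fun j => if β j = true then x.price j + α else x.price j := by
      funext j
      simp only [hω j]
    simp only [withReals, ← h1]
    rfl

theorem MeasurableState.countOne (hf : MeasurableState f) (a : Fin n) :
    MeasurableState fun ω => countOne s' (f ω) a := by
  refine hf.bind (fun ω st => PMatch.countOne s' st a) ?_
  intro x c d hc hd
  rcases hx : x.asg a with _ | _ | j
  · have : ∀ ω, PMatch.countOne s' (withReals x (c ω) (d ω)) a =
        withReals (PMatch.countOne s' x a) (c ω) (d ω) := by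
      intro ω
      simp only [withReals, PMatch.countOne, hx]
      rfl
    simpa only [this] using measurableState_withReals (PMatch.countOne s' x a) hc hd
  · have : ∀ ω, PMatch.countOne s' (withReals x (c ω) (d ω)) a =
        withReals (PMatch.countOne s' x a) (c ω) (d ω) := by
      intro ω
      simp only [withReals, PMatch.countOne, hx]
      rfl
    simpa only [this] using measurableState_withReals (PMatch.countOne s' x a) hc hd
  · refine MeasurableState.of_cover
      (fun β : Bool => {ω | s' ≤ c ω j - d ω a ↔ β = true}) ?_
      (fun ω => ⟨decide (s' ≤ c ω j - d ω a), by simp⟩)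
      (fun β ω => withReals { (PMatch.countOne s' x a) with
        asg := Function.update x.asg a (if β = true then .unmatched else .good j) } (c ω) (d ω))
      (fun _ => measurableState_withReals _ hc hd) ?_
    · intro β
      cases β
      · simpa using measurableSet_lt ((hc j).sub (hd a)) measurable_const
      · simpa using measurableSet_le measurable_const ((hc j).sub (hd a))
    · intro β ω hω
      replace hω : s' ≤ c ω j - d ω a ↔ β = true := hω
      simp only [withReals, PMatch.countOne, hx, hω]
      rfl

theorem MeasurableState.foldl {Φ : Ω → State n k → Fin n → State n k}
    (hΦ : ∀ (g : Ω → State n k) a, MeasurableState g → MeasurableState fun ω => Φ ω (g ω) a)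
    (l : List (Fin n)) (hf : MeasurableState f) :
    MeasurableState fun ω => l.foldl (Φ ω) (f ω) := by
  induction l generalizing f with
  | nil => exact hf
  | cons a l ih => exact ih (hΦ f a hf)

theorem MeasurableState.readRound (hρ : ∀ c t, Measurable fun ω => ρ ω c t)
    (hf : MeasurableState f) :
    MeasurableState fun ω => readRound α s' θ (oracleReader (ρ ω)) tie v (f ω) := by
  refine hf.bind (fun ω st => PMatch.readRound α s' θ (oracleReader (ρ ω)) tie v st) ?_
  intro x c d hc hd
  have h0 := measurableState_withReals x hc hd
  unfold PMatch.readRound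
  by_cases hx : x.halted = true
  · have : ∀ ω, (withReals x (c ω) (d ω)).halted = true := fun _ => hx
    simpa only [this, if_true] using h0
  · have : ∀ ω, ¬(withReals x (c ω) (d ω)).halted = true := fun _ => hx
    simp only [this]
    have h1 := h0.foldl (Φ := fun ω => PMatch.readPropose α s' (oracleReader (ρ ω)) tie v)
      (fun g a hg => hg.readPropose hρ a) (List.finRange n)
    have h2 := h1.foldl (Φ := fun _ => PMatch.countOne s')
      (fun g a hg => hg.countOne a) (List.finRange n)
    refine h2.bind (fun ω st₂ => { st₂ with
      halted := decide (ρ ω none st₂.clock₀ - ρ ω none x.clock₀ < θ) }) ?_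
    intro y c' d' hc' hd'
    refine MeasurableState.of_cover
      (fun β : Bool => {ω | ρ ω none y.clock₀ - ρ ω none x.clock₀ < θ ↔ β = true}) ?_
      (fun ω => ⟨decide (ρ ω none y.clock₀ - ρ ω none x.clock₀ < θ), by simp⟩)
      (fun β ω => withReals { y with halted := β } (c' ω) (d' ω))
      (fun _ => measurableState_withReals _ hc' hd') ?_
    · intro β
      cases β
      · simpa using measurableSet_le measurable_const ((hρ none y.clock₀).sub (hρ none x.clock₀))
      · simpa using measurableSet_lt ((hρ none y.clock₀).sub (hρ none x.clock₀)) measurable_const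
    · intro β ω hω
      replace hω : ρ ω none y.clock₀ - ρ ω none x.clock₀ < θ ↔ β = true := hω
      simp only [withReals, hω, Bool.decide_eq_true]

theorem measurableState_readRun (hρ : ∀ c t, Measurable fun ω => ρ ω c t) (m : ℕ) :
    MeasurableState fun ω => readRun α s' θ (oracleReader (ρ ω)) tie v m := by
  induction m with
  | zero =>
    exact measurableState_withReals (init n k) (c := fun _ _ => 0) (d := fun _ _ => 0)
      (fun _ => measurable_const) (fun _ => measurable_const)
  | succ m ih =>
    unfold readRun at ih ⊢
    simp only [Function.iterate_succ_apply']
    exact ih.readRound hρ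

theorem MeasurableState.measurableSet {p : State n k → Prop} (hf : MeasurableState f)
    (hp : ∀ st, p st ↔ p (discretePart st)) : MeasurableSet {ω | p (f ω)} := by
  have : {ω | p (f ω)} = ⋃ x ∈ Set.range (fun ω => discretePart (f ω)) ∩ {x | p x},
      {ω | discretePart (f ω) = x} := by
    ext ω
    simp only [Set.mem_ofPred_eq, Set.mem_iUnion, exists_prop, Set.mem_inter_iff,
      Set.mem_range_self, true_and, exists_eq_right']
    rw [hp]
  rw [this]
  exact MeasurableSet.biUnion (hf.countable.mono Set.inter_subset_left) fun x _ => hf.fiber x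

end

/-! ### Privacy -/

/-- The family of zero-one streams with ones at the positions in `x`. -/
def decodeStreams {N : ℕ} (x : Finset (Option (Fin k) × Fin (N + 1))) (c : Option (Fin k)) (u : ℕ) :
    ℝ := by
  classical
  exact if ∃ h : u < N + 1, (c, ⟨u, h⟩) ∈ x then 1 else 0

theorem decodeStreams_injective {N : ℕ} : Function.Injective (decodeStreams (k := k) (N := N)) := by
  intro x y h
  ext ⟨c, u⟩
  have := congrFun (congrFun h c) u
  simp only [decodeStreams, Fin.is_lt, Fin.eta, exists_true_left] at this
  split_ifs at this with h1 h2 h2 <;> simp_all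

/-- The streams of the state `st` are `F`. -/
def HasStreams (st : State n k) (F : Option (Fin k) → ℕ → ℝ) : Prop :=
  (∀ j, st.stream j = F (some j)) ∧ st.stream₀ = F none

theorem HasStreams.unique {st : State n k} {F G : Option (Fin k) → ℕ → ℝ} (h : HasStreams st F)
    (h' : HasStreams st G) : F = G := by
  funext c
  cases c with
  | none => exact h.2.symm.trans h'.2
  | some j => exact (h.1 j).symm.trans (h'.1 j)

theorem exists_hasStreams {N : ℕ} {st : State n k} (h : Valid01 st) (h1 : st.clock ≤ N)
    (h2 : st.clock₀ ≤ N) :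
    ∃ x : Finset (Option (Fin k) × Fin (N + 1)), HasStreams st (decodeStreams x) := by
  classical
  let f : Option (Fin k) → ℕ → ℝ := fun c => c.elim st.stream₀ st.stream
  have hf : ∀ c u, f c u = 0 ∨ f c u = 1 ∧ u < N + 1 := by
    rintro (_ | j) u
    · rcases h.stream₀ u with h0 | h0
      · exact Or.inl h0
      · refine Or.inr ⟨h0, ?_⟩
        by_contra hc
        rw [h.after₀ u (by omega)] at h0
        norm_num at h0
    · rcases h.stream j u with h0 | h0
      · exact Or.inl h0
      · refine Or.inr ⟨h0, ?_⟩
        by_contra hc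
        rw [h.after j u (by omega)] at h0
        norm_num at h0
  have key : f = decodeStreams (Finset.univ.filter
      fun p : Option (Fin k) × Fin (N + 1) => f p.1 p.2 = 1) := by
    funext c u
    simp only [decodeStreams, Finset.mem_filter, Finset.mem_univ, true_and]
    rcases hf c u with h0 | ⟨h0, hu⟩
    · simp [h0]
    · simp [h0, hu]
  exact ⟨_, fun j => congrFun key (some j), congrFun key none⟩

section

variable {α : ℝ}

/-- The readings of the counters fed with the streams `F` on the tape `ω`. -/
def readings (F : Option (Fin k) → ℕ → ℝ) (ω : Tape n k α) (c : Option (Fin k)) (t : ℕ) : ℝ :=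
  counter (F c) (noise ω c) t

/-- The shift of the tape that turns the streams `F` into `G` without changing the readings. -/
def tapeShift (F G : Option (Fin k) → ℕ → ℝ) : Tape n k α := fun p =>
  blockSum (fun u => F p.1 u - G p.1 u) (p.2 + 1)

theorem noise_add (ω h : Tape n k α) (c : Option (Fin k)) {t : ℕ} (ht : 0 < t)
    (ht' : t ≤ horizon n α) :
    noise (fun p => ω p + h p) c t = noise ω c t + h (c, ⟨t - 1, by omega⟩) := by
  simp only [noise]
  rw [dif_pos (by omega), dif_pos (by omega)]

theorem readings_tapeShift (F G : Option (Fin k) → ℕ → ℝ) (ω : Tape n k α) (c : Option (Fin k))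
    {t : ℕ} (ht : t ≤ horizon n α) :
    readings G (fun p => ω p + tapeShift F G p) c t = readings F ω c t := by
  unfold readings
  rw [← counter_shift (F c) (G c)]
  refine counter_congr (fun _ _ => rfl) fun u hu hut => ?_
  rw [noise_add ω _ c hu (hut.trans ht), tapeShift, Nat.sub_add_cancel hu]

theorem measurable_readings (F : Option (Fin k) → ℕ → ℝ) (c : Option (Fin k)) (t : ℕ) :
    Measurable fun ω : Tape n k α => readings F ω c t := by
  unfold readings counter
  refine Finset.measurable_sum _ fun i _ => measurable_const.add ?_
  unfold noise
  split_ifs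
  · exact measurable_pi_apply _
  · exact measurable_const

theorem agreeOn_readings (N : ℕ) (F : Option (Fin k) → ℕ → ℝ) (ω : Tape n k α) :
    AgreeOn N F (counterReader (noise ω)) (oracleReader (readings F ω)) :=
  fun _ _ _ _ hσ => counter_congr hσ fun _ _ _ => rfl

theorem sum_abs_tapeShift_le (F G : Option (Fin k) → ℕ → ℝ) :
    ∑ p, |tapeShift (n := n) (α := α) F G p| ≤ logHorizon n α *
      ∑ c, ∑ u ∈ Finset.Ioc 0 (horizon n α), |F c u - G c u| := by
  rw [Fintype.sum_prod_type, Finset.mul_sum]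
  refine Finset.sum_le_sum fun c _ => ?_
  refine le_trans (le_of_eq ?_) (sum_abs_blockSum_le (fun u => F c u - G c u) (horizon n α))
  simp only [tapeShift]
  rw [Fin.sum_univ_eq_sum_range (fun e => |blockSum (fun u => F c u - G c u) (e + 1)|),
    ← Finset.sum_image (f := fun e => |blockSum (fun u => F c u - G c u) e|) (g := (· + 1))
      (by intro a _ b _ h; simpa using h)]
  congr 1
  ext e
  simp only [Finset.mem_image, Finset.mem_range, Finset.mem_Icc]
  constructor
  · rintro ⟨a, ha, rfl⟩; omega
  · rintro ⟨h1, h2⟩; exact ⟨e - 1, by omega, by omega⟩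

variable {s' θ : ℝ} {tie : TieRule n k} {D D' : Fin n → Fin k → ℝ}

/-- On the tape `ω`, the streams of the run on `D` are `F`, and the streams of the run on `D'`
with the same readings are `G`. -/
def StreamPair (s' θ : ℝ) (tie : TieRule n k) (D D' : Fin n → Fin k → ℝ)
    (F G : Option (Fin k) → ℕ → ℝ) (ω : Tape n k α) : Prop :=
  HasStreams (readRun α s' θ (oracleReader (readings F ω)) tie D (rounds α)) F ∧
    HasStreams (readRun α s' θ (oracleReader (readings F ω)) tie D' (rounds α)) G

theorem prefix_of_hasStreams {R : Reader k} {F : Option (Fin k) → ℕ → ℝ}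
    (h : HasStreams (readRun α s' θ R tie D (rounds α)) F) :
    Prefix (horizon n α) F (readRun α s' θ R tie D (rounds α)) :=
  ⟨(valid01_readRun _).2.1, (valid01_readRun _).2.2, fun j u _ => by rw [h.1 j],
    fun u _ => by rw [h.2]⟩

theorem StreamPair.readRun_eq {F G : Option (Fin k) → ℕ → ℝ} {ω : Tape n k α}
    (h : StreamPair s' θ tie D D' F G ω) :
    readRun α s' θ (counterReader (noise ω)) tie D (rounds α) =
      readRun α s' θ (oracleReader (readings F ω)) tie D (rounds α) :=
  (readRun_congr (agreeOn_readings _ F ω).symm (prefix_of_hasStreams h.1)).symm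

theorem StreamPair.shift_readRun_eq {F G : Option (Fin k) → ℕ → ℝ} {ω : Tape n k α}
    (h : StreamPair s' θ tie D D' F G ω) :
    readRun α s' θ (oracleReader (readings G fun p => ω p + tapeShift F G p)) tie D' (rounds α) =
      readRun α s' θ (oracleReader (readings F ω)) tie D' (rounds α) :=
  (readRun_congr (fun c _ _ ht _ => (readings_tapeShift F G ω c ht).symm)
    (prefix_of_hasStreams h.2)).symm

theorem StreamPair.shift {F G : Option (Fin k) → ℕ → ℝ} {ω : Tape n k α}
    (h : StreamPair s' θ tie D D' F G ω) :
    StreamPair s' θ tie D' D G F (fun p => ω p + tapeShift F G p) := by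
  refine ⟨h.shift_readRun_eq.symm ▸ h.2, ?_⟩
  have : readRun α s' θ (oracleReader (readings G fun p => ω p + tapeShift F G p)) tie D (rounds α) =
      readRun α s' θ (oracleReader (readings F ω)) tie D (rounds α) :=
    (readRun_congr (fun c _ _ ht _ => (readings_tapeShift F G ω c ht).symm)
      (prefix_of_hasStreams h.1)).symm
  exact this.symm ▸ h.1

theorem exists_streamPair (s' θ : ℝ) (tie : TieRule n k) (D D' : Fin n → Fin k → ℝ)
    (ω : Tape n k α) :
    ∃ x y : Finset (Option (Fin k) × Fin (horizon n α + 1)),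
      StreamPair s' θ tie D D' (decodeStreams x) (decodeStreams y) ω := by
  have h1 := valid01_readRun (α := α) (s' := s') (θ := θ) (R := counterReader (noise ω))
    (tie := tie) (v := D) (rounds α)
  obtain ⟨x, hx⟩ := exists_hasStreams (N := horizon n α) h1.1 h1.2.1 h1.2.2
  have h2 := valid01_readRun (α := α) (s' := s') (θ := θ)
    (R := oracleReader (readings (decodeStreams x) ω)) (tie := tie) (v := D') (rounds α)
  obtain ⟨y, hy⟩ := exists_hasStreams (N := horizon n α) h2.1 h2.2.1 h2.2.2
  refine ⟨x, y, ?_, hy⟩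
  rwa [← readRun_congr (agreeOn_readings _ _ ω) (prefix_of_hasStreams hx)]

theorem sum_Ioc_eq_of_le {f : ℕ → ℝ} {a b : ℕ} (hab : a ≤ b) (h : ∀ u, a < u → f u = 0) :
    ∑ u ∈ Finset.Ioc 0 b, f u = ∑ u ∈ Finset.Ioc 0 a, f u := by
  refine (Finset.sum_subset (Finset.Ioc_subset_Ioc_right hab) fun u hu hu' => h u ?_).symm
  simp only [Finset.mem_Ioc] at hu hu'
  omega

theorem StreamPair.sum_abs_le {i : Fin n} (hv : ∀ a, a ≠ i → D a = D' a)
    {F G : Option (Fin k) → ℕ → ℝ} {ω : Tape n k α} (h : StreamPair s' θ tie D D' F G ω) :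
    ∑ c, ∑ u ∈ Finset.Ioc 0 (horizon n α), |F c u - G c u| ≤ 2 * (rounds α : ℝ) := by
  have hc := coupled_readRun (α := α) (s' := s') (θ := θ) (ρ := readings F ω) (tie := tie) hv
    (rounds α)
  have h1 := valid01_readRun (α := α) (s' := s') (θ := θ) (R := oracleReader (readings F ω))
    (tie := tie) (v := D) (rounds α)
  have h2 := valid01_readRun (α := α) (s' := s') (θ := θ) (R := oracleReader (readings F ω))
    (tie := tie) (v := D') (rounds α)
  obtain ⟨hF, hG⟩ := h
  refine le_trans (le_of_eq ?_) hc.2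
  rw [Fintype.sum_option, streamDist, add_comm]
  congr 1
  · refine Finset.sum_congr rfl fun j _ => ?_
    rw [← hF.1 j, ← hG.1 j]
    refine sum_Ioc_eq_of_le h1.2.1 fun u hu => ?_
    rw [h1.1.after j u hu, h2.1.after j u (hc.1.clock ▸ hu)]
    simp
  · rw [← hF.2, ← hG.2]
    refine sum_Ioc_eq_of_le h1.2.2 fun u hu => ?_
    rw [h1.1.after₀ u hu, h2.1.after₀ u (hc.1.clock₀ ▸ hu)]
    simp

theorem measurableSet_streamPair (F G : Option (Fin k) → ℕ → ℝ) (p : State n k → Prop)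
    (hp : ∀ st, p st ↔ p (discretePart st)) :
    MeasurableSet {ω : Tape n k α | StreamPair s' θ tie D D' F G ω ∧
      p (readRun α s' θ (oracleReader (readings F ω)) tie D (rounds α))} := by
  have h1 := measurableState_readRun (α := α) (s' := s') (θ := θ) (tie := tie) (v := D)
    (ρ := fun ω : Tape n k α => readings F ω) (measurable_readings F) (rounds α)
  have h2 := measurableState_readRun (α := α) (s' := s') (θ := θ) (tie := tie) (v := D')
    (ρ := fun ω : Tape n k α => readings F ω) (measurable_readings F) (rounds α)
  exact ((h1.measurableSet (p := fun st => HasStreams st F) fun _ => Iff.rfl).inter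
    (h2.measurableSet (p := fun st => HasStreams st G) fun _ => Iff.rfl)).inter
    (h1.measurableSet hp)

end

/-- The assignment that is read off from the final state. -/
def outputOf (st : State n k) : Fin n → Option (Fin k) := fun i =>
  match st.asg i with
  | .good j => some j
  | _ => none

theorem output_eq (s : ℕ) (α ε γ lam opt : ℝ) (tie : TieRule n k) (v : Fin n → Fin k → ℝ)
    (ω : Tape n k α) :
    output n k s α ε γ lam opt tie v ω =
      outputOf (readRun α (s - reserved n k α ε γ)
        (α * opt / (2 * lam) - 2 * errBound n k α ε γ) (counterReader (noise ω)) tie v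
        (rounds α)) := by
  unfold output readRun
  simp only [round_eq]
  rfl

theorem rounds_pos {α : ℝ} (hα : 0 < α) : 0 < rounds α := Nat.ceil_pos.2 (by positivity)

theorem jointDP_output (s : ℕ) {α ε : ℝ} (γ lam opt : ℝ) (tie : TieRule n k) (hα : 0 < α)
    (hε : 0 < ε) (C : Set (Fin k → ℝ)) :
    JointDP (tapeMeasure n k α ε) C (output n k s α ε γ lam opt tie) ε := by
  intro i D D' _ _ hD S
  have hT : (0 : ℝ) < rounds α := by exact_mod_cast rounds_pos hα
  have hN : 0 < horizon n α := Nat.mul_pos (by have := i.2; omega) (rounds_pos hα)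
  have hl : 0 < logHorizon n α := by
    unfold logHorizon
    exact_mod_cast Nat.size_pos.2 hN
  have he : 0 < epsCounter α ε := by unfold epsCounter; positivity
  set s' : ℝ := s - reserved n k α ε γ
  set θ : ℝ := α * opt / (2 * lam) - 2 * errBound n k α ε γ
  let p : State n k → Prop := fun st =>
    (fun j : {j : Fin n // j ≠ i} => outputOf st j) ∈ S
  let X := Finset (Option (Fin k) × Fin (horizon n α + 1))
  let Y : X × X → Set (Tape n k α) := fun z =>
    {ω | StreamPair s' θ tie D D' (decodeStreams z.1) (decodeStreams z.2) ω ∧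
      p (readRun α s' θ (oracleReader (readings (decodeStreams z.1) ω)) tie D (rounds α))}
  let Z : X × X → Set (Tape n k α) := fun z =>
    {ω | StreamPair s' θ tie D' D (decodeStreams z.2) (decodeStreams z.1) ω ∧
      p (readRun α s' θ (oracleReader (readings (decodeStreams z.2) ω)) tie D' (rounds α))}
  have hZ : ∀ z, MeasurableSet (Z z) := fun z =>
    measurableSet_streamPair _ _ p fun _ => Iff.rfl
  have hYZ : ∀ z, tapeMeasure n k α ε (Y z) ≤
      ENNReal.ofReal (Real.exp ε) * tapeMeasure n k α ε (Z z) := by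
    intro z
    rcases (Y z).eq_empty_or_nonempty with hY | ⟨ω₀, hω₀⟩
    · rw [hY, measure_empty]; exact bot_le
    have hb : 0 < logHorizon n α / epsCounter α ε := by positivity
    calc tapeMeasure n k α ε (Y z)
        ≤ tapeMeasure n k α ε ((fun ω q => ω q +
            tapeShift (decodeStreams z.1) (decodeStreams z.2) q) ⁻¹' Z z) := by
          refine measure_mono fun ω hω => ⟨hω.1.shift, ?_⟩
          rw [hω.1.shift_readRun_eq]
          have hc := (coupled_readRun (α := α) (s' := s') (θ := θ)
            (ρ := readings (decodeStreams z.1) ω) (tie := tie) hD (rounds α)).1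
          have h2 := hω.2
          change _ ∈ S at h2
          change _ ∈ S
          convert h2 using 2 with j
          simp only [outputOf, hc.asg j j.2]
      _ ≤ _ := pi_laplace_preimage_add_le hb _ (hZ z)
      _ ≤ _ := by
          refine mul_le_mul_left (ENNReal.ofReal_le_ofReal (Real.exp_le_exp.2 ?_)) _
          rw [div_le_iff₀ hb]
          refine (sum_abs_tapeShift_le _ _).trans ((mul_le_mul_of_nonneg_left
            (hω₀.1.sum_abs_le hD) hl.le).trans (le_of_eq ?_))
          unfold epsCounter
          field_simp
  have hcover : {ω | (fun j : {j : Fin n // j ≠ i} => output n k s α ε γ lam opt tie D ω j) ∈ S} ⊆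
      ⋃ z ∈ (Finset.univ : Finset (X × X)), Y z := by
    intro ω hω
    obtain ⟨x, y, hxy⟩ := exists_streamPair s' θ tie D D' ω
    simp only [Finset.mem_univ, Set.iUnion_true, Set.mem_iUnion]
    refine ⟨(x, y), hxy, ?_⟩
    rw [← hxy.readRun_eq]
    change _ ∈ S at hω
    rwa [output_eq] at hω
  have hsub : (⋃ z ∈ (Finset.univ : Finset (X × X)), Z z) ⊆
      {ω | (fun j : {j : Fin n // j ≠ i} => output n k s α ε γ lam opt tie D' ω j) ∈ S} := by
    intro ω hω
    simp only [Finset.mem_univ, Set.iUnion_true, Set.mem_iUnion] at hω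
    obtain ⟨z, hz, hp⟩ := hω
    rw [← hz.readRun_eq] at hp
    change _ ∈ S
    rwa [output_eq]
  have hdisj : Set.PairwiseDisjoint (↑(Finset.univ : Finset (X × X))) Z := by
    intro z _ z' _ hzz
    refine Set.disjoint_left.2 fun ω hω hω' => hzz ?_
    have h1 := hω.1.readRun_eq
    have h1' := hω'.1.readRun_eq
    have e2 : z.2 = z'.2 := decodeStreams_injective <|
      (h1.symm ▸ hω.1.1 : HasStreams _ _).unique (h1'.symm ▸ hω'.1.1)
    have e1 : z.1 = z'.1 := decodeStreams_injective <| hω.1.2.unique (by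
      rw [e2]; exact hω'.1.2)
    exact Prod.ext e1 e2
  calc _ ≤ tapeMeasure n k α ε (⋃ z ∈ (Finset.univ : Finset (X × X)), Y z) := measure_mono hcover
    _ ≤ ∑ z, tapeMeasure n k α ε (Y z) := measure_biUnion_finset_le _ _
    _ ≤ ∑ z, ENNReal.ofReal (Real.exp ε) * tapeMeasure n k α ε (Z z) :=
        Finset.sum_le_sum fun z _ => hYZ z
    _ = ENNReal.ofReal (Real.exp ε) * tapeMeasure n k α ε
          (⋃ z ∈ (Finset.univ : Finset (X × X)), Z z) := by
        rw [← Finset.mul_sum, measure_biUnion_finset hdisj fun z _ => hZ z]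
    _ ≤ _ := by gcongr

/-! ### Accuracy of the counters -/

theorem pi_laplace_sum_abs_gt_le {ι : Type*} [Fintype ι] {b : ℝ} (hb : 0 < b) (A : Finset ι)
    (E : ℝ) :
    Measure.pi (fun _ : ι => laplace b) {ω | E < ∑ p ∈ A, |ω p|} ≤
      ENNReal.ofReal (2 ^ A.card * Real.exp (-(1 / (2 * b) * E))) := by
  have := isProbabilityMeasure_laplace hb
  set P := Measure.pi (fun _ : ι => laplace b) with hP
  obtain ⟨g, hg⟩ : ∃ g : ℝ → ENNReal,
    g = fun x => ENNReal.ofReal (Real.exp (1 / (2 * b) * |x|)) := ⟨_, rfl⟩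
  have hgm : Measurable g := by rw [hg]; fun_prop
  have hg2 : ∫⁻ x, g x ∂laplace b = 2 := by rw [hg]; exact lintegral_exp_abs_laplace hb
  have hind : ProbabilityTheory.iIndepFun (fun p (ω : ι → ℝ) => g (ω p)) P :=
    ProbabilityTheory.iIndepFun_pi (X := fun _ => g) fun _ => hgm.aemeasurable
  have hint : ∫⁻ ω, ∏ p ∈ A, g (ω p) ∂P = 2 ^ A.card := by
    rw [ProbabilityTheory.lintegral_prod_eq_prod_lintegral_of_indepFun A
      (fun p (ω : ι → ℝ) => g (ω p)) hind (fun p => hgm.comp (measurable_pi_apply p)),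
      ← Finset.prod_const]
    refine Finset.prod_congr rfl fun p _ => ?_
    rw [← hg2]
    exact (measurePreserving_eval (fun _ : ι => laplace b) p).lintegral_comp hgm
  have hm : AEMeasurable (fun ω : ι → ℝ => ∏ p ∈ A, g (ω p)) P :=
    (Finset.measurable_prod A fun p _ => hgm.comp (measurable_pi_apply p)).aemeasurable
  have hpos : ENNReal.ofReal (Real.exp (1 / (2 * b) * E)) ≠ 0 := by simp [Real.exp_pos]
  calc P {ω | E < ∑ p ∈ A, |ω p|}
      ≤ P {ω | ENNReal.ofReal (Real.exp (1 / (2 * b) * E)) ≤ ∏ p ∈ A, g (ω p)} := by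
        refine measure_mono fun ω hω => ?_
        replace hω : E < ∑ p ∈ A, |ω p| := hω
        change ENNReal.ofReal (Real.exp (1 / (2 * b) * E)) ≤ ∏ p ∈ A, g (ω p)
        rw [hg, ← ENNReal.ofReal_prod_of_nonneg fun _ _ => (Real.exp_pos _).le, ← Real.exp_sum,
          ← Finset.mul_sum]
        refine ENNReal.ofReal_le_ofReal (Real.exp_le_exp.2 ?_)
        exact mul_le_mul_of_nonneg_left hω.le (by positivity)
    _ ≤ (∫⁻ ω, ∏ p ∈ A, g (ω p) ∂P) / ENNReal.ofReal (Real.exp (1 / (2 * b) * E)) :=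
        meas_ge_le_lintegral_div hm hpos ENNReal.ofReal_ne_top
    _ = _ := by
        rw [hint, Real.exp_neg, ENNReal.ofReal_mul (by positivity),
          ENNReal.ofReal_inv_of_pos (Real.exp_pos _), ENNReal.ofReal_pow (by norm_num),
          div_eq_mul_inv]
        simp

theorem abs_noiseSum_le {α : ℝ} (c : Option (Fin k)) {t : ℕ}
    (ht : t ≤ horizon n α) :
    ∃ A : Finset (Option (Fin k) × Fin (horizon n α)), A.card ≤ (horizon n α).size ∧
      ∀ ω : Tape n k α, |noiseSum (noise ω c) t| ≤ ∑ p ∈ A, |ω p| := by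
  classical
  set B := (Finset.range t.size).filter (fun i => t.testBit i = true) with hB
  have hpos : ∀ i ∈ B, 0 < t / 2 ^ i * 2 ^ i ∧ t / 2 ^ i * 2 ^ i ≤ horizon n α := by
    intro i hi
    have h := div_pow_mul_pow_eq t i
    rw [if_pos (Finset.mem_filter.1 hi).2] at h
    have : 0 < 2 ^ i := by positivity
    exact ⟨by omega, (Nat.div_mul_le_self _ _).trans ht⟩
  have hinj : Set.InjOn (fun i => t / 2 ^ i * 2 ^ i) B := by
    intro i hi j hj hij
    have h1 := blockLen_of_testBit (Finset.mem_filter.1 hi).2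
    have h2 := blockLen_of_testBit (Finset.mem_filter.1 hj).2
    simp only at hij
    rw [hij, h2] at h1
    exact (Nat.pow_right_injective le_rfl h1).symm
  refine ⟨Finset.univ.filter fun p => p.1 = c ∧ (p.2 : ℕ) + 1 ∈ B.image fun i => t / 2 ^ i * 2 ^ i,
    ?_, fun ω => ?_⟩
  · calc _ ≤ (B.image fun i => t / 2 ^ i * 2 ^ i).card := by
          refine Finset.card_le_card_of_injOn (fun p => (p.2 : ℕ) + 1) ?_ ?_
          · intro p hp
            exact (Finset.mem_filter.1 hp).2.2
          · rintro ⟨c1, p⟩ hp ⟨c2, q⟩ hq hpq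
            have h1 := (Finset.mem_filter.1 hp).2.1
            have h2 := (Finset.mem_filter.1 hq).2.1
            simp only at h1 h2 hpq
            rw [h1, h2, Fin.ext (Nat.succ_injective hpq)]
      _ ≤ B.card := Finset.card_image_le
      _ ≤ t.size := (Finset.card_filter_le _ _).trans_eq (Finset.card_range _)
      _ ≤ _ := Nat.size_le_size ht
  · have h1 : |noiseSum (noise ω c) t| ≤ ∑ e ∈ B.image fun i => t / 2 ^ i * 2 ^ i,
        |noise ω c e| := by
      rw [Finset.sum_image hinj, noiseSum]
      exact Finset.abs_sum_le_sum_abs _ _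
    refine h1.trans ?_
    have hmem : ∀ e ∈ B.image fun i => t / 2 ^ i * 2 ^ i, 0 < e ∧ e ≤ horizon n α := by
      intro e he
      obtain ⟨i, hi, rfl⟩ := Finset.mem_image.1 he
      exact hpos i hi
    refine le_of_eq ?_
    refine Finset.sum_bij (fun e he => (c, ⟨e - 1, by have := hmem e he; omega⟩)) ?_ ?_ ?_ ?_
    · intro e he
      have := hmem e he
      simp only [Finset.mem_filter, Finset.mem_univ, true_and]
      rwa [Nat.sub_add_cancel this.1]
    · intro e he e' he' h
      have := hmem e he
      have := hmem e' he'
      simp only [Prod.mk.injEq, Fin.mk.injEq, true_and] at h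
      omega
    · rintro ⟨c1, p⟩ hp
      obtain ⟨hp1, hp2⟩ := (Finset.mem_filter.1 hp).2
      simp only at hp1 hp2
      exact ⟨p + 1, hp2, by simp [hp1]⟩
    · intro e he
      have := hmem e he
      simp only [noise]
      rw [dif_pos (by omega)]

theorem rounds_ge {α : ℝ} (hα : 0 < α) (hα1 : α < 1) : 24 ≤ rounds α := by
  have h : (24 : ℝ) ≤ 24 / α ^ 2 := by
    rw [le_div_iff₀ (by positivity)]
    nlinarith
  exact_mod_cast h.trans (Nat.le_ceil _)

theorem logHorizon_ge {α : ℝ} (hn : 0 < n) (hα : 0 < α) (hα1 : α < 1) : 2 ≤ logHorizon n α := by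
  have h1 : 2 ≤ horizon n α := by
    have := rounds_ge hα hα1
    unfold horizon
    nlinarith
  have h2 : 1 < (horizon n α).size := Nat.lt_size.2 (by simpa using h1)
  unfold logHorizon
  exact_mod_cast h2

theorem epsCounter_pos {α ε : ℝ} (hα : 0 < α) (hε : 0 < ε) : 0 < epsCounter α ε := by
  have : (0 : ℝ) < rounds α := by exact_mod_cast rounds_pos hα
  unfold epsCounter
  positivity

theorem one_lt_log_four_mul_div {γ : ℝ} (hk : 0 < k) (hγ : 0 < γ) (hγ1 : γ < 1) :
    1 < Real.log (4 * k / γ) := by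
  have hk' : (1 : ℝ) ≤ k := by exact_mod_cast hk
  rw [Real.lt_log_iff_exp_lt (by positivity), lt_div_iff₀ hγ]
  have := Real.exp_one_lt_d9
  nlinarith

theorem four_mul_sq_le_errBound {α ε γ : ℝ} (hn : 0 < n) (hk : 0 < k) (hα : 0 < α) (hα1 : α < 1)
    (hε : 0 < ε) (hγ : 0 < γ) (hγ1 : γ < 1) :
    4 * logHorizon n α ^ 2 * Real.log (4 * k / γ) / epsCounter α ε ≤ errBound n k α ε γ := by
  have hl := logHorizon_ge hn hα hα1
  have he := epsCounter_pos hα hε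
  have hL := one_lt_log_four_mul_div hk hγ hγ1
  have h1 : Real.sqrt 2 * logHorizon n α ^ 2 ≤ logHorizon n α ^ (5 / 2 : ℝ) := by
    rw [show (5 / 2 : ℝ) = 1 / 2 + (2 : ℕ) by norm_num, Real.rpow_add_natCast (by linarith),
      ← Real.sqrt_eq_rpow]
    gcongr
  have h2 : Real.sqrt 2 * Real.sqrt 2 = 2 := Real.mul_self_sqrt (by norm_num)
  unfold errBound
  calc 4 * logHorizon n α ^ 2 * Real.log (4 * k / γ) / epsCounter α ε
      = 2 * Real.sqrt 2 / epsCounter α ε * (Real.sqrt 2 * logHorizon n α ^ 2) *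
          Real.log (4 * k / γ) := by
        field_simp
        nlinarith
    _ ≤ _ := by gcongr

theorem one_sub_le_measure_noise {α ε γ : ℝ} (hn : 0 < n) (hk : 0 < k) (hα : 0 < α) (hα1 : α < 1)
    (hε : 0 < ε) (hγ : 0 < γ) (hγ1 : γ < 1) :
    ENNReal.ofReal (1 - γ) ≤ tapeMeasure n k α ε
      {ω | ∀ c t, t ≤ horizon n α → |noiseSum (noise ω c) t| ≤ errBound n k α ε γ} := by
  have hl := logHorizon_ge hn hα hα1
  have he := epsCounter_pos hα hε
  have hL := one_lt_log_four_mul_div hk hγ hγ1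
  have hb : 0 < logHorizon n α / epsCounter α ε := by positivity
  have := isProbabilityMeasure_laplace hb
  have hP : IsProbabilityMeasure (tapeMeasure n k α ε) := by unfold tapeMeasure; infer_instance
  set P := tapeMeasure n k α ε with hPdef
  set E := errBound n k α ε γ
  set l := (horizon n α).size with hldef
  have hll : logHorizon n α = l := rfl
  have hk' : (1 : ℝ) ≤ k := by exact_mod_cast hk
  set δ : ℝ := 2 ^ l * Real.exp (-(1 / (2 * (logHorizon n α / epsCounter α ε)) * E)) with hδ
  have hsingle : ∀ c : Option (Fin k), ∀ t, t ≤ horizon n α →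
      P {ω | E < |noiseSum (noise ω c) t|} ≤ ENNReal.ofReal δ := by
    intro c t ht
    obtain ⟨A, hA, hA'⟩ := abs_noiseSum_le (α := α) c ht
    calc P {ω | E < |noiseSum (noise ω c) t|} ≤ P {ω | E < ∑ p ∈ A, |ω p|} :=
          measure_mono fun ω (hω : E < _) => hω.trans_le (hA' ω)
      _ ≤ _ := pi_laplace_sum_abs_gt_le hb A E
      _ ≤ _ := by
          refine ENNReal.ofReal_le_ofReal ?_
          rw [hδ]
          gcongr
          norm_num
  have hδle : ((k : ℝ) + 1) * (horizon n α + 1 : ℕ) * δ ≤ γ := by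
    have h1 : ((horizon n α + 1 : ℕ) : ℝ) ≤ 2 ^ l := by
      exact_mod_cast Nat.lt_size_self (horizon n α)
    have h2 : 2 * l * Real.log (4 * k / γ) ≤
        1 / (2 * (logHorizon n α / epsCounter α ε)) * E := by
      refine le_trans (le_of_eq ?_) (mul_le_mul_of_nonneg_left
        (four_mul_sq_le_errBound hn hk hα hα1 hε hγ hγ1) (by positivity))
      rw [← hll]
      field_simp
      ring
    have h3 : Real.exp (-(1 / (2 * (logHorizon n α / epsCounter α ε)) * E)) ≤
        (γ / (4 * k)) ^ (2 * l) := by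
      calc _ ≤ Real.exp (-(2 * l * Real.log (4 * k / γ))) := by gcongr
        _ = _ := by
          rw [show -(2 * l * Real.log (4 * k / γ)) = ((2 * l : ℕ) : ℝ) * -Real.log (4 * k / γ) by
            push_cast; ring, Real.exp_nat_mul, ← Real.log_inv, Real.exp_log (by positivity),
            inv_div]
    have h4 : (γ / (2 * k)) ^ (2 * l) ≤ (γ / (2 * k)) ^ 2 := by
      refine pow_le_pow_of_le_one (by positivity) ?_ ?_
      · rw [div_le_one (by positivity)]; linarith
      · have : (1 : ℝ) ≤ l := by rw [← hll]; linarith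
        have : 1 ≤ l := by exact_mod_cast this
        omega
    calc ((k : ℝ) + 1) * (horizon n α + 1 : ℕ) * δ
        ≤ ((k : ℝ) + 1) * 2 ^ l * (2 ^ l * (γ / (4 * k)) ^ (2 * l)) := by
          rw [hδ]; gcongr
      _ = ((k : ℝ) + 1) * (γ / (2 * k)) ^ (2 * l) := by
          rw [show γ / (2 * k) = 2 * (γ / (4 * k)) by field_simp; norm_num, mul_pow 2,
            two_mul l, pow_add 2]
          ring
      _ ≤ (2 * k) * (γ / (2 * k)) ^ 2 := by
          gcongr; linarith
      _ ≤ γ := by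
          rw [div_pow, mul_div_assoc', div_le_iff₀ (by positivity)]
          have h5 : γ ^ 2 ≤ γ * (2 * k) := by nlinarith
          nlinarith [mul_le_mul_of_nonneg_left h5 (by positivity : (0 : ℝ) ≤ 2 * k)]
  have hbad : P {ω | ∀ c t, t ≤ horizon n α → |noiseSum (noise ω c) t| ≤ E}ᶜ ≤
      ENNReal.ofReal γ := by
    calc _ ≤ P (⋃ c ∈ (Finset.univ : Finset (Option (Fin k))),
          ⋃ t ∈ Finset.range (horizon n α + 1), {ω | E < |noiseSum (noise ω c) t|}) := by
          refine measure_mono fun ω hω => ?_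
          simp only [Set.mem_compl_iff, Set.mem_ofPred_eq, not_forall, not_le] at hω
          obtain ⟨c, t, ht, h⟩ := hω
          simp only [Set.mem_iUnion]
          exact ⟨c, Finset.mem_univ c, t, Finset.mem_range.2 (Nat.lt_succ_of_le ht), h⟩
      _ ≤ ∑ c : Option (Fin k), ∑ t ∈ Finset.range (horizon n α + 1), ENNReal.ofReal δ := by
          refine (measure_biUnion_finset_le _ _).trans (Finset.sum_le_sum fun c _ => ?_)
          refine (measure_biUnion_finset_le _ _).trans (Finset.sum_le_sum fun t ht => ?_)
          exact hsingle c t (Nat.lt_succ_iff.1 (Finset.mem_range.1 ht))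
      _ = ENNReal.ofReal (((k : ℝ) + 1) * (horizon n α + 1 : ℕ) * δ) := by
          clear_value δ
          rw [ENNReal.ofReal_mul (by positivity), ENNReal.ofReal_mul (by positivity),
            ENNReal.ofReal_natCast]
          have : ENNReal.ofReal ((k : ℝ) + 1) = ((k + 1 : ℕ) : ENNReal) := by
            rw [← ENNReal.ofReal_natCast]; push_cast; rfl
          rw [this]
          simp [mul_assoc]
      _ ≤ _ := ENNReal.ofReal_le_ofReal hδle
  rw [ENNReal.ofReal_sub _ hγ.le, ENNReal.ofReal_one, tsub_le_iff_right]
  calc (1 : ENNReal) = P Set.univ := measure_univ.symm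
    _ ≤ P {ω | ∀ c t, t ≤ horizon n α → |noiseSum (noise ω c) t| ≤ E} +
        P {ω | ∀ c t, t ≤ horizon n α → |noiseSum (noise ω c) t| ≤ E}ᶜ := by
        rw [← Set.union_compl_self {ω | ∀ c t, t ≤ horizon n α → |noiseSum (noise ω c) t| ≤ E}]
        exact measure_union_le _ _
    _ ≤ _ := by gcongr

/-! ### Invariants of a run with accurate counters -/

/-- Invariants of the goods: `X j` is the number of bids on `j`, and `α * q j` the price. -/
structure GoodsInv (α s' E : ℝ) (st : State n k) (X q : Fin k → ℕ) : Prop where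
  stream : ∀ j, ∑ u ∈ Finset.Ioc 0 st.clock, st.stream j u = X j
  count : ∀ j, |st.count j - X j| ≤ E
  price : ∀ j, st.price j = α * q j
  count_lt : ∀ j, st.count j < (q j + 1) * s'
  price_le : ∀ j, q j = 0 ∨ q j * s' - E ≤ X j

/-- The ghost data of the bidders: `rank i` is the number of the last bid of `i` among the bids on
the same good, `α * level i` the price at which she bid, and `who j r` made the `r`-th bid
on `j`. -/
structure Ghost (n k : ℕ) : Type where
  rank : Fin n → ℕ
  level : Fin n → ℕ
  who : Fin k → ℕ → Fin n

/-- Invariants of the bidders. -/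
structure BiddersInv (α s' E : ℝ) (v : Fin n → Fin k → ℝ) (asg : Fin n → Status k)
    (saved : Fin n → ℝ) (price : Fin k → ℝ) (X : Fin k → ℕ) (g : Ghost n k) : Prop where
  who : ∀ i j, asg i = .good j → g.who j (g.rank i) = i
  rank_pos : ∀ i j, asg i = .good j → 1 ≤ g.rank i
  rank_le : ∀ i j, asg i = .good j → g.rank i ≤ X j
  saved : ∀ i j, asg i = .good j → |saved i - (g.rank i - 1)| ≤ E
  rank_lt : ∀ i j, asg i = .good j → (g.rank i : ℝ) - 1 < (g.level i + 1) * s' + E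
  profit : ∀ i j, asg i = .good j → 0 < v i j - α * g.level i
  favourite : ∀ i j, asg i = .good j → ∀ j', v i j' - price j' ≤ v i j - α * g.level i
  dummy : ∀ i, asg i = .dummy → ∀ j, v i j ≤ price j
  window : ∀ j r, 1 ≤ r → r ≤ X j → (X j : ℝ) + 1 + 2 * E - s' < r →
    asg (g.who j r) = .good j ∧ g.rank (g.who j r) = r

section

variable {α s' θ E : ℝ} {η : Option (Fin k) → ℕ → ℝ} {N : ℕ} {tie : TieRule n k}
  {v : Fin n → Fin k → ℝ} {st : State n k} {X q : Fin k → ℕ} {g : Ghost n k}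

/-- The number of bids after the bid `b`. -/
def addBid (X : Fin k → ℕ) (b : Option (Fin k)) (j : Fin k) : ℕ := X j + if b = some j then 1 else 0

theorem sum_addBid (X : Fin k → ℕ) (b : Option (Fin k)) :
    ∑ j, (addBid X b j : ℝ) = ∑ j, (X j : ℝ) + if b.isSome then 1 else 0 := by
  simp only [addBid, Nat.cast_add, Finset.sum_add_distrib]
  congr 1
  cases b <;> simp

theorem GoodsInv.readPropose (hα : 0 < α) (hE : 1 ≤ E) (hs : 3 * E ≤ s')
    (hη : ∀ c t, t ≤ N → |noiseSum (η c) t| ≤ E) (h : GoodsInv α s' E st X q)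
    (hN : st.clock + 1 ≤ N) (i : Fin n) :
    (∃ q', GoodsInv α s' E (readPropose α s' (counterReader η) tie v st i)
      (addBid X (choice tie v st i)) q') ∧
      ∀ j, st.price j ≤ (PMatch.readPropose α s' (counterReader η) tie v st i).price j := by
  set st' := PMatch.readPropose α s' (counterReader η) tie v st i with hst'
  set b := choice tie v st i
  have hsum : ∀ j, ∑ u ∈ Finset.Ioc 0 st'.clock, st'.stream j u = addBid X b j := by
    intro j
    change ∑ u ∈ Finset.Ioc 0 (st.clock + 1), Function.update (st.stream j) (st.clock + 1)
      (if b = some j then 1 else 0) u = _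
    rw [Finset.sum_Ioc_succ_top (Nat.zero_le _), Function.update_self, addBid, Nat.cast_add,
      ← h.stream j]
    congr 1
    · refine Finset.sum_congr rfl fun u hu => Function.update_of_ne ?_ _ _
      have := (Finset.mem_Ioc.1 hu).2
      omega
    · split_ifs <;> simp
  have hcount : ∀ j, |st'.count j - addBid X b j| ≤ E := by
    intro j
    have : st'.count j = counter (st'.stream j) (η (some j)) st'.clock := rfl
    rw [this, counter_eq, hsum j, add_sub_cancel_left]
    exact hη _ _ hN
  have hprice : ∀ j, st'.price j = if (q j + 1) * s' ≤ st'.count j then st.price j + α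
      else st.price j := by
    intro j
    have : st'.price j = if (st.price j / α + 1) * s' ≤ st'.count j then st.price j + α
      else st.price j := rfl
    rw [this, h.price j, mul_div_cancel_left₀ _ hα.ne']
  have hadd : ∀ j, (X j : ℝ) ≤ addBid X b j ∧ (addBid X b j : ℝ) ≤ X j + 1 := by
    intro j
    unfold addBid
    push_cast
    split_ifs <;> constructor <;> linarith
  refine ⟨⟨fun j => if (q j + 1) * s' ≤ st'.count j then q j + 1 else q j, hsum, hcount,
    fun j => ?_, fun j => ?_, fun j => ?_⟩, fun j => ?_⟩
  · rw [hprice j, h.price j]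
    split_ifs
    · push_cast; ring
    · rfl
  · split_ifs with hc
    · have h1 := abs_le.1 (hcount j)
      have h2 := abs_le.1 (h.count j)
      have h3 := h.count_lt j
      have h4 := hadd j
      push_cast
      linarith
    · exact not_le.1 hc
  · split_ifs with hc
    · right
      have h1 := abs_le.1 (hcount j)
      push_cast
      linarith
    · rcases h.price_le j with h0 | h0
      · exact Or.inl h0
      · exact Or.inr (h0.trans (hadd j).1)
  · rw [hprice j]
    split_ifs <;> linarith

theorem BiddersInv.mono_price {asg : Fin n → Status k} {saved : Fin n → ℝ} {p p' : Fin k → ℝ}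
    (h : BiddersInv α s' E v asg saved p X g) (hp : ∀ j, p j ≤ p' j) :
    BiddersInv α s' E v asg saved p' X g :=
  ⟨h.who, h.rank_pos, h.rank_le, h.saved, h.rank_lt, h.profit,
    fun i j hi j' => by linarith [h.favourite i j hi j', hp j'],
    fun i hi j => (h.dummy i hi j).trans (hp j), h.window⟩

theorem BiddersInv.set_dummy {asg : Fin n → Status k} {saved : Fin n → ℝ} {p : Fin k → ℝ}
    (h : BiddersInv α s' E v asg saved p X g) {i : Fin n} (hi : asg i = .unmatched)
    (hd : ∀ j, v i j ≤ p j) :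
    BiddersInv α s' E v (Function.update asg i .dummy) saved p X g := by
  have key : ∀ a j, Function.update asg i .dummy a = .good j → asg a = .good j := by
    intro a j ha
    by_cases hai : a = i
    · subst hai; simp at ha
    · rwa [Function.update_of_ne hai] at ha
  refine ⟨fun a j ha => h.who a j (key a j ha), fun a j ha => h.rank_pos a j (key a j ha),
    fun a j ha => h.rank_le a j (key a j ha), fun a j ha => h.saved a j (key a j ha),
    fun a j ha => h.rank_lt a j (key a j ha), fun a j ha => h.profit a j (key a j ha),
    fun a j ha => h.favourite a j (key a j ha), fun a ha => ?_, fun j r h1 h2 h3 => ?_⟩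
  · by_cases hai : a = i
    · subst hai; exact hd
    · rw [Function.update_of_ne hai] at ha
      exact h.dummy a ha
  · obtain ⟨h4, h5⟩ := h.window j r h1 h2 h3
    refine ⟨?_, h5⟩
    rw [Function.update_of_ne, h4]
    intro hc
    rw [hc, hi] at h4
    cases h4

theorem BiddersInv.set_good {asg : Fin n → Status k} {saved : Fin n → ℝ} {p : Fin k → ℝ}
    (h : BiddersInv α s' E v asg saved p X g) {i : Fin n} (hi : asg i = .unmatched)
    {j₀ : Fin k} {c : ℝ} {l : ℕ} (hc : |c - X j₀| ≤ E) (hl : (X j₀ : ℝ) < (l + 1) * s' + E)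
    (hpos : 0 < v i j₀ - α * l) (hfav : ∀ j, v i j - p j ≤ v i j₀ - α * l) :
    BiddersInv α s' E v (Function.update asg i (.good j₀)) (Function.update saved i c) p
      (addBid X (some j₀))
      ⟨Function.update g.rank i (X j₀ + 1), Function.update g.level i l,
        Function.update g.who j₀ (Function.update (g.who j₀) (X j₀ + 1) i)⟩ := by
  have hX : ∀ j, X j ≤ addBid X (some j₀) j := fun j => Nat.le_add_right _ _
  have hX₀ : addBid X (some j₀) j₀ = X j₀ + 1 := by simp [addBid]
  have hX' : ∀ j, j ≠ j₀ → addBid X (some j₀) j = X j := by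
    intro j hj
    simp [addBid, hj.symm]
  have self : ∀ j, Function.update asg i (.good j₀) i = .good j → j = j₀ := by
    intro j hj
    rw [Function.update_self] at hj
    cases hj; rfl
  constructor
  · intro a j ha
    by_cases hai : a = i
    · subst hai
      rw [self j ha]
      simp
    · rw [Function.update_of_ne hai] at ha
      have h1 := h.rank_le a j ha
      have h2 := h.who a j ha
      simp only [Function.update_of_ne hai]
      by_cases hj : j = j₀
      · subst hj
        rw [Function.update_self, Function.update_of_ne (by omega), h2]
      · rw [Function.update_of_ne hj, h2]
  · intro a j ha
    by_cases hai : a = i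
    · subst hai; simp
    · rw [Function.update_of_ne hai] at ha
      simpa only [Function.update_of_ne hai] using h.rank_pos a j ha
  · intro a j ha
    by_cases hai : a = i
    · subst hai; rw [self j ha, hX₀]; simp
    · rw [Function.update_of_ne hai] at ha
      simpa only [Function.update_of_ne hai] using (h.rank_le a j ha).trans (hX j)
  · intro a j ha
    by_cases hai : a = i
    · subst hai; simpa using hc
    · rw [Function.update_of_ne hai] at ha
      simpa only [Function.update_of_ne hai] using h.saved a j ha
  · intro a j ha
    by_cases hai : a = i
    · subst hai; simpa using hl
    · rw [Function.update_of_ne hai] at ha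
      simpa only [Function.update_of_ne hai] using h.rank_lt a j ha
  · intro a j ha
    by_cases hai : a = i
    · subst hai; rw [self j ha]; simpa using hpos
    · rw [Function.update_of_ne hai] at ha
      simpa only [Function.update_of_ne hai] using h.profit a j ha
  · intro a j ha
    by_cases hai : a = i
    · subst hai; rw [self j ha]; simpa using hfav
    · rw [Function.update_of_ne hai] at ha
      simpa only [Function.update_of_ne hai] using h.favourite a j ha
  · intro a ha
    by_cases hai : a = i
    · subst hai; simp at ha
    · rw [Function.update_of_ne hai] at ha
      exact h.dummy a ha
  · intro j r h1 h2 h3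
    have old : ∀ r, 1 ≤ r → r ≤ X j → (X j : ℝ) + 1 + 2 * E - s' < r → g.who j r ≠ i ∧
        Function.update asg i (.good j₀) (g.who j r) = .good j ∧
        Function.update g.rank i (X j₀ + 1) (g.who j r) = r := by
      intro r h1 h2 h3
      obtain ⟨h4, h5⟩ := h.window j r h1 h2 h3
      have hne : g.who j r ≠ i := by
        intro hc
        rw [hc, hi] at h4
        cases h4
      exact ⟨hne, by rw [Function.update_of_ne hne, h4], by rw [Function.update_of_ne hne, h5]⟩
    by_cases hj : j = j₀
    · subst hj
      rw [hX₀] at h2 h3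
      push_cast at h3
      by_cases hr : r = X j + 1
      · subst hr; simp
      · simp only [Function.update_self, Function.update_of_ne hr]
        exact (old r h1 (by omega) (by linarith)).2
    · rw [hX' j hj] at h2 h3
      simp only [Function.update_of_ne hj]
      exact (old r h1 h2 h3).2

theorem BiddersInv.unassign {asg asg' : Fin n → Status k} {saved : Fin n → ℝ} {p c : Fin k → ℝ}
    (h : BiddersInv α s' E v asg saved p X g) (hc : ∀ j, |c j - X j| ≤ E)
    (h' : ∀ i, asg' i = asg i ∨
      asg' i = .unmatched ∧ ∃ j, asg i = .good j ∧ s' ≤ c j - saved i) :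
    BiddersInv α s' E v asg' saved p X g := by
  have key : ∀ i a, a ≠ .unmatched → asg' i = a → asg i = a := by
    intro i a ha hi
    rcases h' i with h1 | ⟨h1, -⟩
    · rw [← h1, hi]
    · exact absurd (hi.symm.trans h1) ha
  have key' : ∀ i j, asg' i = .good j → asg i = .good j := fun i j => key i _ (by simp)
  refine ⟨fun a j ha => h.who a j (key' a j ha), fun a j ha => h.rank_pos a j (key' a j ha),
    fun a j ha => h.rank_le a j (key' a j ha), fun a j ha => h.saved a j (key' a j ha),
    fun a j ha => h.rank_lt a j (key' a j ha), fun a j ha => h.profit a j (key' a j ha),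
    fun a j ha => h.favourite a j (key' a j ha), fun a ha => h.dummy a (key a _ (by simp) ha),
    fun j r h1 h2 h3 => ?_⟩
  obtain ⟨h4, h5⟩ := h.window j r h1 h2 h3
  refine ⟨?_, h5⟩
  rcases h' (g.who j r) with h6 | ⟨-, j', h6, h7⟩
  · rw [h6, h4]
  · exfalso
    rw [h4] at h6
    cases h6
    have h8 := abs_le.1 (h.saved _ j h4)
    have h9 := abs_le.1 (hc j)
    rw [h5] at h8
    linarith

/-- The number (zero or one) that bidder `a` feeds to the halting counter. -/
def bidInd (hb : Fin n → Bool) (a : ℕ) : ℝ := if h : a < n then (if hb ⟨a, h⟩ then 1 else 0) else 0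

/-- Invariants of the phase in which the first `m` bidders have proposed, relative to the state
`st₀`, with `X₀` bids, at the beginning of the round. -/
structure ProposeInv (α s' E : ℝ) (v : Fin n → Fin k → ℝ) (st₀ : State n k) (X₀ : Fin k → ℕ)
    (m : ℕ) (st : State n k) (X q : Fin k → ℕ) (g : Ghost n k) : Prop where
  goods : GoodsInv α s' E st X q
  bidders : BiddersInv α s' E v st.asg st.saved st.price X g
  fresh : ∀ i j, st.asg i = .good j → (X₀ j : ℝ) + 1 - s' - 2 * E < g.rank i
  le : ∀ j, X₀ j ≤ X j
  sum : ∑ j, (X j : ℝ) = ∑ j, (X₀ j : ℝ) + ∑ a ∈ Finset.range m, bidInd st.hasBid a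
  asg : ∀ i : Fin n, (i : ℕ) < m → st.asg i ≠ .unmatched
  clock : st.clock = st₀.clock + m
  clock₀ : st.clock₀ = st₀.clock₀
  stream₀ : st.stream₀ = st₀.stream₀

theorem ProposeInv.step (hα : 0 < α) (hE : 1 ≤ E) (hs : 3 * E ≤ s')
    (hη : ∀ c t, t ≤ N → |noiseSum (η c) t| ≤ E) (htie : tie.Valid) {st₀ : State n k}
    {X₀ : Fin k → ℕ} {i : Fin n} (hN : st₀.clock + n ≤ N)
    (h : ∃ X q g, ProposeInv α s' E v st₀ X₀ i st X q g) :
    ∃ X q g, ProposeInv α s' E v st₀ X₀ (i + 1) (readPropose α s' (counterReader η) tie v st i)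
      X q g := by
  obtain ⟨X, q, g, h⟩ := h
  have hclock : st.clock + 1 ≤ N := by rw [h.clock]; have := i.2; omega
  obtain ⟨⟨q', hq'⟩, hp⟩ := h.goods.readPropose (tie := tie) (v := v) hα hE hs hη hclock i
  set st' := readPropose α s' (counterReader η) tie v st i with hst'
  have hhb : st'.hasBid = Function.update st.hasBid i (choice tie v st i).isSome := rfl
  have hsum : ∑ j, (addBid X (choice tie v st i) j : ℝ) = ∑ j, (X₀ j : ℝ) +
      ∑ a ∈ Finset.range (i + 1), bidInd st'.hasBid a := by
    rw [sum_addBid, h.sum, Finset.sum_range_succ, ← add_assoc]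
    congr 1
    · congr 1
      refine Finset.sum_congr rfl fun a ha => ?_
      have ha' := Finset.mem_range.1 ha
      have hlt : a < n := ha'.trans i.2
      have hne : (⟨a, hlt⟩ : Fin n) ≠ i := fun hc => by
        rw [← hc] at ha'; simp at ha'
      simp only [bidInd, dif_pos hlt, hhb, Function.update_of_ne hne]
    · simp only [bidInd, dif_pos i.2, hhb, Fin.eta, Function.update_self]
  have hle : ∀ j, X₀ j ≤ addBid X (choice tie v st i) j := fun j =>
    (h.le j).trans (Nat.le_add_right _ _)
  have hasg : st'.asg = Function.update st.asg i (nextStatus (choice tie v st i) (st.asg i)) := rfl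
  have hclock' : st'.clock = st₀.clock + (i + 1) := by
    rw [← add_assoc, ← h.clock]; rfl
  have hnot : ∀ a : Fin n, (a : ℕ) < i + 1 → st'.asg a ≠ .unmatched := by
    intro a ha
    rw [hasg]
    by_cases hai : a = i
    · subst hai
      rw [Function.update_self]
      unfold nextStatus
      cases st.asg a <;> cases choice tie v st a <;> simp
    · rw [Function.update_of_ne hai]
      refine h.asg a ?_
      have : (a : ℕ) ≠ i := fun hc => hai (Fin.ext hc)
      omega
  have hsaved : st'.saved = (choice tie v st i).elim st.saved
    (fun j => Function.update st.saved i (st.count j)) := rfl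
  by_cases hi : st.asg i = .unmatched
  · set j₀ := tie (st.clock + 1) i (v i) st.price with hj₀
    have hfav := fun j => htie (st.clock + 1) i (v i) st.price j
    by_cases hle0 : v i j₀ - st.price j₀ ≤ 0
    · have hb : choice tie v st i = none := by
        unfold choice; rw [hi]; exact if_pos hle0
      rw [hb, hi] at hasg
      rw [hb] at hq' hsum hle hsaved
      have hX : addBid X none = X := by funext j; simp [addBid]
      rw [hX] at hq' hsum hle
      refine ⟨X, q', g, hq', ?_, ?_, hle, hsum, hnot, hclock', h.clock₀, h.stream₀⟩
      · rw [hasg, hsaved]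
        exact (h.bidders.set_dummy hi fun j => by linarith [hfav j]).mono_price hp
      · intro a j ha
        rw [hasg] at ha
        by_cases hai : a = i
        · subst hai; simp [nextStatus] at ha
        · rw [Function.update_of_ne hai] at ha
          exact h.fresh a j ha
    · have hb : choice tie v st i = some j₀ := by
        unfold choice; rw [hi]; exact if_neg hle0
      rw [hb, hi] at hasg
      rw [hb] at hq' hsum hle hsaved
      have hpr := h.goods.price j₀
      have hcnt := h.goods.count j₀
      have hset := h.bidders.set_good (l := q j₀) hi hcnt
        (by have := h.goods.count_lt j₀; have := (abs_le.1 hcnt).1; linarith)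
        (by rw [← hpr]; linarith) (fun j => by rw [← hpr]; exact hfav j)
      refine ⟨_, q', ⟨Function.update g.rank i (X j₀ + 1), Function.update g.level i (q j₀),
        Function.update g.who j₀ (Function.update (g.who j₀) (X j₀ + 1) i)⟩, hq', ?_, ?_, hle, hsum,
        hnot, hclock', h.clock₀, h.stream₀⟩
      · rw [hasg, hsaved]
        exact hset.mono_price hp
      · intro a j ha
        rw [hasg] at ha
        by_cases hai : a = i
        · subst hai
          rw [Function.update_self] at ha
          rw [← Status.good.inj ha]
          have : (X₀ j₀ : ℝ) ≤ X j₀ := by exact_mod_cast h.le j₀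
          simp only [Function.update_self]
          push_cast
          linarith
        · rw [Function.update_of_ne hai] at ha
          simpa only [Function.update_of_ne hai] using h.fresh a j ha
  · have hb : choice tie v st i = none := by
      unfold choice
      cases hc : st.asg i <;> simp_all
    have hns : nextStatus (k := k) none (st.asg i) = st.asg i := by
      cases hc : st.asg i <;> simp_all [nextStatus]
    rw [hb, hns, Function.update_eq_self] at hasg
    rw [hb] at hq' hsum hle hsaved
    have hX : addBid X none = X := by funext j; simp [addBid]
    rw [hX] at hq' hsum hle
    refine ⟨X, q', g, hq', ?_, ?_, hle, hsum, hnot, hclock', h.clock₀, h.stream₀⟩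
    · rw [hasg, hsaved]
      exact h.bidders.mono_price hp
    · rw [hasg]
      exact h.fresh

/-- The status of a bidder after `CountBids`. -/
def countStatus (s' : ℝ) (st : State n k) (i : Fin n) : Status k :=
  match st.asg i with
  | .good j => if s' ≤ st.count j - st.saved i then .unmatched else .good j
  | a => a

theorem foldl_countOne (st : State n k) :
    ∃ stream₀, (List.finRange n).foldl (countOne s') st =
      { st with
        asg := countStatus s' st
        clock₀ := st.clock₀ + n
        stream₀ := stream₀ } ∧
      (∀ u, u ≤ st.clock₀ → stream₀ u = st.stream₀ u) ∧
      ∑ u ∈ Finset.Ioc 0 (st.clock₀ + n), stream₀ u = ∑ u ∈ Finset.Ioc 0 st.clock₀, st.stream₀ u +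
        ∑ a ∈ Finset.range n, bidInd st.hasBid a := by
  have key := foldl_finRange_induction (fun m st' => ∃ asg stream₀, st' =
      { st with
        asg := asg
        clock₀ := st.clock₀ + m
        stream₀ := stream₀ } ∧
      (∀ i : Fin n, asg i = if (i : ℕ) < m then countStatus s' st i else st.asg i) ∧
      (∀ u, u ≤ st.clock₀ → stream₀ u = st.stream₀ u) ∧
      ∑ u ∈ Finset.Ioc 0 (st.clock₀ + m), stream₀ u = ∑ u ∈ Finset.Ioc 0 st.clock₀, st.stream₀ u +
        ∑ a ∈ Finset.range m, bidInd st.hasBid a) (countOne s') st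
    ⟨st.asg, st.stream₀, rfl, by simp, by simp, by simp⟩ (by
      rintro i _ ⟨asg, stream₀, rfl, h1, h2, h3⟩
      refine ⟨_, _, rfl, fun a => ?_, fun u hu => ?_, ?_⟩
      · by_cases hai : a = i
        · subst hai
          have := h1 a
          rw [if_neg (lt_irrefl _)] at this
          rw [Function.update_self, if_pos (Nat.lt_succ_self _)]
          simp only [this]
          rfl
        · have : (a : ℕ) ≠ i := fun hc => hai (Fin.ext hc)
          rw [Function.update_of_ne hai]
          simp only
          rw [h1]
          have : (a : ℕ) < i + 1 ↔ (a : ℕ) < i := by omega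
          simp only [this]
      · rw [Function.update_of_ne (by simp only; omega)]
        exact h2 u hu
      · simp only
        rw [← add_assoc, Finset.sum_Ioc_succ_top (Nat.zero_le _), Function.update_self,
          Finset.sum_range_succ, ← add_assoc, ← h3]
        congr 1
        · refine Finset.sum_congr rfl fun u hu => Function.update_of_ne ?_ _ _
          have := (Finset.mem_Ioc.1 hu).2
          omega
        · simp [bidInd])
  obtain ⟨asg, stream₀, h1, h2, h3, h4⟩ := key
  refine ⟨stream₀, ?_, h3, h4⟩
  have : asg = countStatus s' st := by
    funext i
    rw [h2 i, if_pos i.2]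
  rw [h1, this]

end

theorem card_le_of_forall_mem_Ioc {S : Finset ℕ} {a b : ℝ} (hab : a ≤ b)
    (h : ∀ r ∈ S, a < r ∧ (r : ℝ) ≤ b) : (S.card : ℝ) ≤ b - a + 1 := by
  rcases S.eq_empty_or_nonempty with rfl | hS
  · simp; linarith
  have h1 : S.card ≤ S.max' hS + 1 - S.min' hS := by
    rw [← Nat.card_Icc]
    exact Finset.card_le_card fun r hr =>
      Finset.mem_Icc.2 ⟨S.min'_le r hr, S.le_max' r hr⟩
  have h2 : S.min' hS ≤ S.max' hS := S.min'_le _ (S.max'_mem hS)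
  have h3 : S.card + S.min' hS ≤ S.max' hS + 1 := by omega
  have h4 : (S.card : ℝ) + S.min' hS ≤ S.max' hS + 1 := by exact_mod_cast h3
  have h5 := (h _ (S.min'_mem hS)).1
  have h6 := (h _ (S.max'_mem hS)).2
  linarith

section

variable {α s' θ E : ℝ} {η : Option (Fin k) → ℕ → ℝ} {N m : ℕ} {tie : TieRule n k}
  {v : Fin n → Fin k → ℝ} {st : State n k} {X q : Fin k → ℕ} {g : Ghost n k}

/-- Invariants after `m` rounds. -/
structure RoundInv (α s' E : ℝ) (v : Fin n → Fin k → ℝ) (m : ℕ) (st : State n k)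
    (X q : Fin k → ℕ) (g : Ghost n k) : Prop where
  goods : GoodsInv α s' E st X q
  bidders : BiddersInv α s' E v st.asg st.saved st.price X g
  kept : ∀ i j, st.asg i = .good j → st.count j - st.saved i < s'
  sum : ∑ u ∈ Finset.Ioc 0 st.clock₀, st.stream₀ u = ∑ j, (X j : ℝ)
  clock : st.clock = n * m
  clock₀ : st.clock₀ = n * m

theorem BiddersInv.card_le {asg : Fin n → Status k} {saved : Fin n → ℝ} {p : Fin k → ℝ}
    (h : BiddersInv α s' E v asg saved p X g) {U : Finset (Fin n)} {j : Fin k}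
    (hU : ∀ i ∈ U, asg i = .good j) {a b : ℝ} (hab : a ≤ b)
    (hr : ∀ i ∈ U, a < g.rank i ∧ (g.rank i : ℝ) ≤ b) : (U.card : ℝ) ≤ b - a + 1 := by
  have : U.card = (U.image g.rank).card := by
    refine (Finset.card_image_of_injOn fun i hi i' hi' hii => ?_).symm
    rw [← h.who i j (hU i hi), ← h.who i' j (hU i' hi'), hii]
  rw [this]
  refine card_le_of_forall_mem_Ioc hab fun r hrr => ?_
  obtain ⟨i, hi, rfl⟩ := Finset.mem_image.1 hrr
  exact hr i hi

/-- The bidders who are unmatched. -/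
def unmatchedSet (asg : Fin n → Status k) : Finset (Fin n) := by
  classical
  exact Finset.univ.filter fun i => asg i = .unmatched

theorem ProposeInv.card_unmatched_le (hE : 1 ≤ E) {X₀ : Fin k → ℕ} {st₀ : State n k}
    (h : ProposeInv α s' E v st₀ X₀ n st X q g) :
    ((unmatchedSet (countStatus s' st)).card : ℝ) ≤ ∑ j, (X j : ℝ) - ∑ j, (X₀ j : ℝ) +
      (4 * E + 1) * (Finset.univ.filter fun j => s' - 2 * E ≤ X j).card := by
  classical
  have hsub : unmatchedSet (countStatus s' st) ⊆ Finset.univ.biUnion fun j =>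
      Finset.univ.filter fun i => st.asg i = .good j ∧ s' ≤ st.count j - st.saved i := by
    intro i hi
    have h1 : countStatus s' st i = .unmatched := (Finset.mem_filter.1 hi).2
    have h2 := h.asg i i.2
    simp only [Finset.mem_biUnion, Finset.mem_univ, Finset.mem_filter, true_and]
    unfold countStatus at h1
    cases hc : st.asg i with
    | unmatched => exact absurd hc h2
    | dummy => rw [hc] at h1; simp at h1
    | good j =>
      rw [hc] at h1
      simp only at h1
      split_ifs at h1 with h3
      exact ⟨j, rfl, h3⟩
  have hj : ∀ j, ((Finset.univ.filter fun i =>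
      st.asg i = .good j ∧ s' ≤ st.count j - st.saved i).card : ℝ) ≤
      (X j : ℝ) - X₀ j + if s' - 2 * E ≤ X j then 4 * E + 1 else 0 := by
    intro j
    have hle : (X₀ j : ℝ) ≤ X j := by exact_mod_cast h.le j
    have hrank : ∀ i, st.asg i = .good j → s' ≤ st.count j - st.saved i →
        (g.rank i : ℝ) ≤ X j + 1 + 2 * E - s' := by
      intro i hi hs
      have h1 := abs_le.1 (h.bidders.saved i j hi)
      have h2 := abs_le.1 (h.goods.count j)
      linarith
    by_cases hX : s' - 2 * E ≤ X j
    · rw [if_pos hX]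
      refine (h.bidders.card_le (j := j) (a := X₀ j + 1 - s' - 2 * E)
        (b := X j + 1 + 2 * E - s') (fun i hi => (Finset.mem_filter.1 hi).2.1) (by linarith)
        fun i hi => ?_).trans (by linarith)
      obtain ⟨-, h1, h2⟩ := Finset.mem_filter.1 hi
      exact ⟨h.fresh i j h1, hrank i h1 h2⟩
    · rw [if_neg hX]
      have : (Finset.univ.filter fun i =>
          st.asg i = .good j ∧ s' ≤ st.count j - st.saved i) = ∅ := by
        refine Finset.filter_eq_empty_iff.2 fun i _ hi => hX ?_
        have h1 := hrank i hi.1 hi.2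
        have h2 : (1 : ℝ) ≤ g.rank i := by exact_mod_cast h.bidders.rank_pos i j hi.1
        linarith
      rw [this]
      simpa using hle
  calc ((unmatchedSet (countStatus s' st)).card : ℝ)
      ≤ ∑ j, ((Finset.univ.filter fun i =>
          st.asg i = .good j ∧ s' ≤ st.count j - st.saved i).card : ℝ) := by
        exact_mod_cast (Finset.card_le_card hsub).trans Finset.card_biUnion_le
    _ ≤ ∑ j, ((X j : ℝ) - X₀ j + if s' - 2 * E ≤ X j then 4 * E + 1 else 0) :=
        Finset.sum_le_sum fun j _ => hj j
    _ = _ := by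
        rw [Finset.sum_add_distrib, Finset.sum_sub_distrib, ← Finset.sum_filter, Finset.sum_const,
          nsmul_eq_mul]
        ring

theorem RoundInv.step (hα : 0 < α) (hE : 1 ≤ E) (hs : 3 * E ≤ s')
    (hη : ∀ c t, t ≤ N → |noiseSum (η c) t| ≤ E) (htie : tie.Valid) (hN : n * (m + 1) ≤ N)
    (h : RoundInv α s' E v m st X q g) (hh : st.halted = false) :
    ∃ X' q' g', RoundInv α s' E v (m + 1) (readRound α s' θ (counterReader η) tie v st) X' q' g' ∧
      ((readRound α s' θ (counterReader η) tie v st).halted = false →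
        θ - 2 * E ≤ ∑ j, (X' j : ℝ) - ∑ j, (X j : ℝ)) ∧
      ((readRound α s' θ (counterReader η) tie v st).halted = true →
        ((unmatchedSet (readRound α s' θ (counterReader η) tie v st).asg).card : ℝ) ≤
          θ + 2 * E + (4 * E + 1) *
            (Finset.univ.filter fun j => s' - 2 * E ≤ X' j).card) := by
  have hN' : st.clock + n ≤ N := by rw [h.clock]; linarith
  have h0 : ProposeInv α s' E v st X 0 st X q g := by
    refine ⟨h.goods, h.bidders, fun i j hi => ?_, fun _ => le_rfl, by simp, by simp, rfl, rfl, rfl⟩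
    have h1 := abs_le.1 (h.bidders.saved i j hi)
    have h2 := abs_le.1 (h.goods.count j)
    have h3 := h.kept i j hi
    linarith
  obtain ⟨X', q', g', h1⟩ := foldl_finRange_induction
    (fun a st' => ∃ X' q' g', ProposeInv α s' E v st X a st' X' q' g')
    (readPropose α s' (counterReader η) tie v) st ⟨X, q, g, h0⟩
    (fun i st' h' => ProposeInv.step hα hE hs hη htie hN' h')
  set st₁ := (List.finRange n).foldl (readPropose α s' (counterReader η) tie v) st with hst₁
  obtain ⟨stream₀, h2, h3, h4⟩ := foldl_countOne (s' := s') st₁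
  have hround : readRound α s' θ (counterReader η) tie v st =
      { st₁ with
        asg := countStatus s' st₁
        clock₀ := st₁.clock₀ + n
        stream₀ := stream₀
        halted := decide (counter stream₀ (η none) (st₁.clock₀ + n) -
          counter st.stream₀ (η none) st.clock₀ < θ) } := by
    unfold readRound
    rw [if_neg (by simp [hh])]
    simp only [← hst₁, h2]
    rfl
  rw [hround]
  have hsum : ∑ u ∈ Finset.Ioc 0 (st₁.clock₀ + n), stream₀ u = ∑ j, (X' j : ℝ) := by
    rw [h4, h1.sum, h1.clock₀, h1.stream₀, h.sum]
  have hdiff : counter stream₀ (η none) (st₁.clock₀ + n) - counter st.stream₀ (η none) st.clock₀ =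
      ∑ j, (X' j : ℝ) - ∑ j, (X j : ℝ) + noiseSum (η none) (st₁.clock₀ + n) -
        noiseSum (η none) st.clock₀ := by
    rw [counter_eq, counter_eq, hsum, h.sum]; ring
  have hn1 := abs_le.1 (hη none (st₁.clock₀ + n) (by rw [h1.clock₀, h.clock₀]; linarith))
  have hn2 := abs_le.1 (hη none st.clock₀ (by rw [h.clock₀]; linarith))
  have hcs : ∀ i, countStatus s' st₁ i = st₁.asg i ∨ countStatus s' st₁ i = .unmatched ∧
      ∃ j, st₁.asg i = .good j ∧ s' ≤ st₁.count j - st₁.saved i := by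
    intro i
    unfold countStatus
    cases st₁.asg i with
    | unmatched => exact Or.inl rfl
    | dummy => exact Or.inl rfl
    | good j =>
      simp only
      split_ifs with hc
      · exact Or.inr ⟨rfl, j, rfl, hc⟩
      · exact Or.inl rfl
  refine ⟨X', q', g', ⟨⟨h1.goods.1, h1.goods.2, h1.goods.3, h1.goods.4, h1.goods.5⟩,
    h1.bidders.unassign h1.goods.count hcs, ?_, hsum, ?_, ?_⟩, ?_, ?_⟩
  · intro i j hi
    change countStatus s' st₁ i = .good j at hi
    unfold countStatus at hi
    cases hc : st₁.asg i with
    | unmatched => rw [hc] at hi; simp at hi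
    | dummy => rw [hc] at hi; simp at hi
    | good j' =>
      rw [hc] at hi
      simp only at hi
      split_ifs at hi with hcc
      rw [← Status.good.inj hi]
      exact not_le.1 hcc
  · change st₁.clock = _
    rw [h1.clock, h.clock]; ring
  · change st₁.clock₀ + n = _
    rw [h1.clock₀, h.clock₀]; ring
  · intro hd
    have hd' := of_decide_eq_false hd
    rw [hdiff] at hd'
    linarith
  · intro hd
    have hd' := of_decide_eq_true hd
    rw [hdiff] at hd'
    have := h1.card_unmatched_le hE
    refine this.trans ?_
    linarith

theorem exists_roundInv_init (hn : 0 < n) (hE : 1 ≤ E) (hs : 3 * E ≤ s') :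
    ∃ g, RoundInv α s' E v 0 (init n k) (fun _ => 0) (fun _ => 0) g := by
  refine ⟨⟨fun _ => 0, fun _ => 0, fun _ _ => ⟨0, hn⟩⟩, ⟨?_, ?_, ?_, ?_, ?_⟩, ?_, ?_, ?_, ?_, ?_⟩
  · intro j; simp [init]
  · intro j; simp [init]; linarith
  · intro j; simp [init]
  · intro j; simp [init]; linarith
  · intro j; exact Or.inl rfl
  · have hg : ∀ i j, (init n k).asg i ≠ .good j := fun i j hi => by cases hi
    exact ⟨fun i j hi => (hg i j hi).elim, fun i j hi => (hg i j hi).elim,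
      fun i j hi => (hg i j hi).elim, fun i j hi => (hg i j hi).elim,
      fun i j hi => (hg i j hi).elim, fun i j hi => (hg i j hi).elim,
      fun i j hi => (hg i j hi).elim,
      fun i hi => (by cases hi), fun j r h1 h2 => (by omega)⟩
  · intro i j hi; cases hi
  · simp [init]
  · simp [init]
  · simp [init]

/-- After `m` rounds, either each round so far had many bids, or the algorithm has halted with few
unmatched bidders. -/
theorem exists_roundInv (hn : 0 < n) (hα : 0 < α) (hE : 1 ≤ E) (hs : 3 * E ≤ s')
    (hη : ∀ c t, t ≤ N → |noiseSum (η c) t| ≤ E) (htie : tie.Valid) (hN : n * m ≤ N) :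
    ∃ m' X q g, RoundInv α s' E v m' (readRun α s' θ (counterReader η) tie v m) X q g ∧
      if (readRun α s' θ (counterReader η) tie v m).halted = true then
        ((unmatchedSet (readRun α s' θ (counterReader η) tie v m).asg).card : ℝ) ≤
          θ + 2 * E + (4 * E + 1) * (Finset.univ.filter fun j => s' - 2 * E ≤ X j).card
      else m' = m ∧ m * (θ - 2 * E) ≤ ∑ j, (X j : ℝ) := by
  induction m with
  | zero =>
    obtain ⟨g, hg⟩ := exists_roundInv_init (α := α) (v := v) hn hE hs
    refine ⟨0, _, _, g, hg, ?_⟩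
    rw [if_neg (by simp [readRun, init])]
    simp
  | succ m ih =>
    obtain ⟨m', X, q, g, h1, h2⟩ := ih ((Nat.mul_le_mul_left _ (Nat.le_succ _)).trans hN)
    have hsucc : readRun α s' θ (counterReader η) tie v (m + 1) =
        readRound α s' θ (counterReader η) tie v (readRun α s' θ (counterReader η) tie v m) := by
      unfold readRun
      rw [Function.iterate_succ_apply']
    rw [hsucc]
    set st := readRun α s' θ (counterReader η) tie v m
    by_cases hh : st.halted = true
    · have : readRound α s' θ (counterReader η) tie v st = st := by
        unfold readRound; rw [if_pos hh]
      rw [this]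
      rw [if_pos hh] at h2
      exact ⟨m', X, q, g, h1, by rwa [if_pos hh]⟩
    · rw [if_neg hh] at h2
      obtain ⟨rfl, h2⟩ := h2
      obtain ⟨X', q', g', h3, h4, h5⟩ := h1.step (θ := θ) hα hE hs hη htie hN (by simpa using hh)
      refine ⟨m' + 1, X', q', g', h3, ?_⟩
      split_ifs with hc
      · exact h5 hc
      · refine ⟨rfl, ?_⟩
        have := h4 (by simpa using hc)
        push_cast
        linarith

/-! ### Consequences of the invariants -/

/-- The bidders who hold good `j`. -/
def holders (asg : Fin n → Status k) (j : Fin k) : Finset (Fin n) := by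
  classical
  exact Finset.univ.filter fun i => asg i = .good j

theorem mem_holders {asg : Fin n → Status k} {j : Fin k} {i : Fin n} :
    i ∈ holders asg j ↔ asg i = .good j := by
  simp [holders]

theorem RoundInv.card_holders_le (hE : 1 ≤ E) (hs : 0 ≤ s') (h : RoundInv α s' E v m st X q g)
    (j : Fin k) : ((holders st.asg j).card : ℝ) ≤ s' + 2 * E := by
  have := h.bidders.card_le (U := holders st.asg j) (j := j) (a := X j + 1 - 2 * E - s') (b := X j)
    (fun i hi => mem_holders.1 hi) (by linarith) (fun i hi => ?_)
  · linarith
  · have hi' := mem_holders.1 hi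
    have h1 := abs_le.1 (h.bidders.saved i j hi')
    have h2 := abs_le.1 (h.goods.count j)
    have h3 := h.kept i j hi'
    exact ⟨by linarith, by exact_mod_cast h.bidders.rank_le i j hi'⟩

theorem BiddersInv.min_le_card_holders {asg : Fin n → Status k} {saved : Fin n → ℝ}
    {p : Fin k → ℝ} (h : BiddersInv α s' E v asg saved p X g) (j : Fin k) :
    min (X j : ℝ) (s' - 2 * E - 1) ≤ (holders asg j).card := by
  set a : ℝ := X j + 1 + 2 * E - s' with ha
  have hmem : ∀ r ∈ Finset.Ioc ⌊a⌋₊ (X j), 1 ≤ r ∧ r ≤ X j ∧ a < r := by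
    intro r hr
    obtain ⟨h1, h2⟩ := Finset.mem_Ioc.1 hr
    exact ⟨by omega, h2, Nat.lt_of_floor_lt h1⟩
  have h1 : (Finset.Ioc ⌊a⌋₊ (X j)).card ≤ (holders asg j).card := by
    refine Finset.card_le_card_of_injOn (g.who j) ?_ ?_
    · intro r hr
      obtain ⟨h1, h2, h3⟩ := hmem r hr
      exact mem_holders.2 (h.window j r h1 h2 h3).1
    · intro r hr r' hr' hrr
      obtain ⟨h1, h2, h3⟩ := hmem r hr
      obtain ⟨h1', h2', h3'⟩ := hmem r' hr'
      rw [← (h.window j r h1 h2 h3).2, ← (h.window j r' h1' h2' h3').2, hrr]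
  rw [Nat.card_Ioc] at h1
  have h2 : X j ≤ (holders asg j).card + ⌊a⌋₊ := by omega
  have h3 : (X j : ℝ) ≤ (holders asg j).card + (⌊a⌋₊ : ℝ) := by exact_mod_cast h2
  rcases le_or_gt 0 a with ha0 | ha0
  · have := Nat.floor_le ha0
    exact (min_le_right _ _).trans (by linarith)
  · rw [Nat.floor_of_nonpos ha0.le] at h3
    exact (min_le_left _ _).trans (by simpa using h3)

theorem RoundInv.price_le (hα : 0 < α) (hs : 5 * E ≤ s') (hE : 1 ≤ E)
    (h : RoundInv α s' E v m st X q g) {i : Fin n} {j : Fin k} (hi : st.asg i = .good j) :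
    st.price j ≤ α * g.level i + 2 * α := by
  have h1 := abs_le.1 (h.bidders.saved i j hi)
  have h2 := abs_le.1 (h.goods.count j)
  have h3 := h.kept i j hi
  have h4 := h.bidders.rank_lt i j hi
  have h5 : q j ≤ g.level i + 2 := by
    rcases h.goods.price_le j with h0 | h0
    · omega
    · by_contra hc
      have h6 : ((g.level i : ℝ) + 3) ≤ q j := by
        have : g.level i + 3 ≤ q j := by omega
        exact_mod_cast this
      have h7 : ((g.level i : ℝ) + 3) * s' ≤ q j * s' :=
        mul_le_mul_of_nonneg_right h6 (by linarith)
      nlinarith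
  have h6 : (q j : ℝ) ≤ g.level i + 2 := by exact_mod_cast h5
  rw [h.goods.price j]
  nlinarith

end

/-! ### Approximate market equilibria -/

/-- The number of copies of good `j` that are used. -/
def usage (μ : Fin n → Option (Fin k)) (j : Fin k) : ℕ :=
  (Finset.univ.filter fun i => μ i = some j).card

theorem sum_elim_eq (μ : Fin n → Option (Fin k)) (p : Fin k → ℝ) :
    ∑ i, (μ i).elim 0 p = ∑ j, p j * usage μ j := by
  have h1 : ∀ i, (μ i).elim 0 p = ∑ j, if μ i = some j then p j else 0 := by
    intro i
    cases μ i <;> simp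
  rw [Finset.sum_congr rfl fun i _ => h1 i, Finset.sum_comm]
  refine Finset.sum_congr rfl fun j _ => ?_
  rw [← Finset.sum_filter, Finset.sum_const, nsmul_eq_mul, mul_comm, usage]

theorem finite_welfare_image (s : ℕ) (v : Fin n → Fin k → ℝ) :
    (welfare v '' {μ | IsMatching s μ}).Finite := (Set.toFinite _).image _

theorem welfare_le_optWelfare {s : ℕ} {v : Fin n → Fin k → ℝ} {μ : Fin n → Option (Fin k)}
    (h : IsMatching s μ) : welfare v μ ≤ optWelfare s v :=
  le_csSup (finite_welfare_image s v).bddAbove ⟨μ, h, rfl⟩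

theorem exists_welfare_eq_optWelfare (s : ℕ) (v : Fin n → Fin k → ℝ) :
    ∃ μ, IsMatching s μ ∧ welfare v μ = optWelfare s v := by
  have hne : (welfare v '' {μ | IsMatching s μ}).Nonempty :=
    ⟨_, fun _ => none, fun j => by simp, rfl⟩
  exact hne.csSup_mem (finite_welfare_image s v)

theorem mul_sum_usage_le_welfare {v : Fin n → Fin k → ℝ} {μ : Fin n → Option (Fin k)} {lam : ℝ}
    (h : ∀ i j, μ i = some j → lam ≤ v i j) : lam * ∑ j, (usage μ j : ℝ) ≤ welfare v μ := by
  rw [Finset.mul_sum, ← sum_elim_eq μ fun _ => lam, welfare]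
  refine Finset.sum_le_sum fun i _ => ?_
  cases hi : μ i with
  | none => simp
  | some j => simpa using h i j hi

/-- The welfare of an assignment in which each bidder outside of `U` gets a `2 * α`-favourite good
is nearly optimal. -/
theorem welfare_le_of_equilibrium {s : ℕ} {v : Fin n → Fin k → ℝ} {α : ℝ} {p : Fin k → ℝ}
    {μ ν : Fin n → Option (Fin k)} {U : Finset (Fin n)} (hp : ∀ j, 0 ≤ p j)
    (hv : ∀ i j, v i j ≤ 1)
    (hsome : ∀ i j, μ i = some j → 0 ≤ v i j - p j + 2 * α ∧
      ∀ j', v i j' - p j' ≤ v i j - p j + 2 * α)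
    (hnone : ∀ i, μ i = none → i ∈ U ∨ ∀ j, v i j ≤ p j) (hν : IsMatching s ν) :
    welfare v ν ≤ welfare v μ + ∑ j, p j * (s - usage μ j) + 2 * α * ∑ j, (usage μ j : ℝ) +
      U.card := by
  classical
  have key : ∀ i, (ν i).elim 0 (v i) - (ν i).elim 0 p ≤
      (μ i).elim 0 (v i) - (μ i).elim 0 p + (μ i).elim 0 (fun _ => 2 * α) +
        if i ∈ U then 1 else 0 := by
    intro i
    have hU : (0 : ℝ) ≤ if i ∈ U then 1 else 0 := by split_ifs <;> norm_num
    cases hi : μ i with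
    | none =>
      simp only [Option.elim_none]
      cases hj : ν i with
      | none => simpa using hU
      | some j =>
        simp only [Option.elim_some]
        rcases hnone i hi with h | h
        · rw [if_pos h]; linarith [hv i j, hp j]
        · linarith [h j]
    | some j =>
      obtain ⟨h1, h2⟩ := hsome i j hi
      simp only [Option.elim_some]
      cases hj : ν i with
      | none => simp only [Option.elim_none]; linarith
      | some j' => simp only [Option.elim_some]; linarith [h2 j']
  have hsum := Finset.sum_le_sum fun i (_ : i ∈ Finset.univ) => key i
  rw [Finset.sum_sub_distrib, Finset.sum_add_distrib, Finset.sum_add_distrib,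
    Finset.sum_sub_distrib, sum_elim_eq ν p, sum_elim_eq μ p, sum_elim_eq μ fun _ => 2 * α,
    ← Finset.mul_sum, Finset.sum_ite_mem, Finset.univ_inter, Finset.sum_const, nsmul_eq_mul,
    mul_one] at hsum
  have h1 : ∑ j, p j * (usage ν j : ℝ) ≤ ∑ j, p j * (s : ℝ) :=
    Finset.sum_le_sum fun j _ => mul_le_mul_of_nonneg_left (by exact_mod_cast hν j) (hp j)
  have h2 : ∑ j, p j * ((s : ℝ) - usage μ j) = ∑ j, p j * (s : ℝ) - ∑ j, p j * (usage μ j : ℝ) := by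
    rw [← Finset.sum_sub_distrib]
    exact Finset.sum_congr rfl fun j _ => by ring
  unfold welfare
  linarith

theorem outputOf_eq_some {st : State n k} {i : Fin n} {j : Fin k} :
    outputOf st i = some j ↔ st.asg i = .good j := by
  unfold outputOf
  cases st.asg i <;> simp

theorem outputOf_eq_none {st : State n k} {i : Fin n} (h : outputOf st i = none) :
    st.asg i = .unmatched ∨ st.asg i = .dummy := by
  unfold outputOf at h
  cases hi : st.asg i <;> simp_all

theorem usage_outputOf (st : State n k) (j : Fin k) :
    usage (outputOf st) j = (holders st.asg j).card := by
  unfold usage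
  congr 1
  ext i
  simp [mem_holders, outputOf_eq_some]

section

variable {α s' θ E lam : ℝ} {m s : ℕ} {v : Fin n → Fin k → ℝ} {st : State n k}
  {X q : Fin k → ℕ} {g : Ghost n k}

theorem RoundInv.lam_le (hlam : ∀ i j, v i j ≠ 0 → lam ≤ v i j) (hα : 0 < α)
    (h : RoundInv α s' E v m st X q g) {i : Fin n} {j : Fin k} (hi : st.asg i = .good j) :
    lam ≤ v i j := by
  refine hlam i j fun h0 => ?_
  have h1 := h.bidders.profit i j hi
  rw [h0] at h1
  have : 0 ≤ α * (g.level i : ℝ) := by positivity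
  linarith

theorem RoundInv.price_le_of_holder (hv : ∀ i j, v i j ≤ 1) (hα : 0 < α) (hs : 5 * E ≤ s')
    (hE : 1 ≤ E) (h : RoundInv α s' E v m st X q g) {j : Fin k}
    (hj : 0 < (holders st.asg j).card) : st.price j ≤ 1 + 2 * α := by
  obtain ⟨i, hi⟩ := Finset.card_pos.1 hj
  have hi' := mem_holders.1 hi
  have h1 := h.price_le hα hs hE hi'
  have h2 := h.bidders.profit i j hi'
  linarith [hv i j]

theorem RoundInv.card_holders_ge (h : RoundInv α s' E v m st X q g)
    {j : Fin k} (hj : s' - 2 * E ≤ X j) :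
    s' - 2 * E - 1 ≤ (holders st.asg j).card :=
  (le_min (by linarith) le_rfl).trans (h.bidders.min_le_card_holders j)

theorem RoundInv.sub_le_of_pos (hE : 1 ≤ E) (hs : 5 * E ≤ s') (h : RoundInv α s' E v m st X q g)
    {j : Fin k} (hj : q j ≠ 0) : s' - 2 * E ≤ X j := by
  rcases h.goods.price_le j with h0 | h0
  · exact absurd h0 hj
  · have : (1 : ℝ) ≤ q j := by exact_mod_cast Nat.one_le_iff_ne_zero.2 hj
    have hs0 : 0 ≤ s' := le_trans (by linarith) hs
    nlinarith

/-- The number of bids on a good is bounded by the number of its holders. -/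
theorem RoundInv.bids_le (hv : ∀ i j, v i j ≤ 1) (hα : 0 < α) (hα1 : α < 1)
    (hs : 24 * E / α ≤ s') (hE : 1 ≤ E) (h : RoundInv α s' E v m st X q g) (j : Fin k) :
    (X j : ℝ) ≤ 5 / α * (holders st.asg j).card := by
  have hEα : E ≤ E / α := by rw [le_div_iff₀ hα]; nlinarith
  have h1α : 1 ≤ 1 / α := by rw [le_div_iff₀ hα]; linarith
  have hs' : 24 * (E / α) ≤ s' := by rw [← mul_div_assoc]; exact hs
  have hN := h.bidders.min_le_card_holders j
  set H : ℝ := ((holders st.asg j).card : ℝ) with hH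
  have hH0 : 0 ≤ H := Nat.cast_nonneg _
  have h5 : 5 ≤ 5 / α := by rw [le_div_iff₀ hα]; linarith
  by_cases hq : q j = 0
  · have hX : (X j : ℝ) < s' + E := by
      have h1 := (abs_le.1 (h.goods.count j)).1
      have h2 := h.goods.count_lt j
      rw [hq] at h2
      simp only [Nat.cast_zero, zero_add, one_mul] at h2
      linarith
    rcases min_le_iff.1 hN with h1 | h1
    · nlinarith
    · nlinarith
  · have hX := h.sub_le_of_pos hE (by linarith) hq
    have hge := h.card_holders_ge hX
    have hpos : 0 < (holders st.asg j).card := by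
      have : (0 : ℝ) < (holders st.asg j).card := by linarith
      exact_mod_cast this
    have hp := h.price_le_of_holder hv hα (by linarith) hE hpos
    rw [h.goods.price j] at hp
    have hq' : (q j : ℝ) ≤ 1 / α + 2 := by
      rw [← sub_nonneg]
      have : 0 ≤ (1 + 2 * α - α * q j) / α := div_nonneg (by linarith) hα.le
      have e : (1 + 2 * α - α * q j) / α = 1 / α + 2 - q j := by field_simp
      linarith
    have h1 := (abs_le.1 (h.goods.count j)).1
    have h2 := h.goods.count_lt j
    have h3 : ((q j : ℝ) + 1) * s' ≤ (1 / α + 3) * s' :=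
      mul_le_mul_of_nonneg_right (by linarith) (by linarith)
    have h4 : (X j : ℝ) ≤ (1 / α + 3) * s' + E := by linarith
    have h6 : (1 / α + 3) * s' + E ≤ (1 / α + 4) * (s' - 2 * E - 1) := by
      have : 1 / α * (2 * E + 1) ≤ 3 * (E / α) := by
        rw [one_div_mul_eq_div, ← mul_div_assoc]
        gcongr
        linarith
      nlinarith
    calc (X j : ℝ) ≤ (1 / α + 4) * (s' - 2 * E - 1) := h4.trans h6
      _ ≤ (1 / α + 4) * H := mul_le_mul_of_nonneg_left hge (by positivity)
      _ ≤ 5 / α * H := by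
        refine mul_le_mul_of_nonneg_right ?_ hH0
        have : 5 / α = 1 / α + 4 * (1 / α) := by ring
        linarith

theorem RoundInv.isMatching (hE : 1 ≤ E) (hs : 0 ≤ s') (hss : (s : ℝ) = s' + (2 * E + 1))
    (h : RoundInv α s' E v m st X q g) : IsMatching s (outputOf st) := by
  intro j
  have h1 := h.card_holders_le hE hs j
  rw [← usage_outputOf] at h1
  have h2 : (usage (outputOf st) j : ℝ) ≤ s := by linarith
  exact_mod_cast h2

theorem RoundInv.sum_holders_le (hlam : ∀ i j, v i j ≠ 0 → lam ≤ v i j) (hα : 0 < α) (hE : 1 ≤ E)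
    (hs : 0 ≤ s') (hss : (s : ℝ) = s' + (2 * E + 1)) (h : RoundInv α s' E v m st X q g) :
    lam * ∑ j, ((holders st.asg j).card : ℝ) ≤ optWelfare s v := by
  have h1 := mul_sum_usage_le_welfare (μ := outputOf st) (lam := lam) (v := v)
    fun i j hij => h.lam_le hlam hα (outputOf_eq_some.1 hij)
  simp only [usage_outputOf] at h1
  exact h1.trans (welfare_le_optWelfare (h.isMatching hE hs hss))

theorem RoundInv.card_popular_le (hlam0 : 0 < lam) (hlam : ∀ i j, v i j ≠ 0 → lam ≤ v i j)
    (hα : 0 < α) (hα1 : α < 1) (hE : 1 ≤ E)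
    (hs : 24 * E / α ≤ s') (hss : (s : ℝ) = s' + (2 * E + 1)) (h : RoundInv α s' E v m st X q g) :
    21 * E * ((Finset.univ.filter fun j => s' - 2 * E ≤ X j).card : ℝ) ≤
      α / lam * optWelfare s v := by
  have hEα : E ≤ E / α := by rw [le_div_iff₀ hα]; nlinarith
  have hs' : 24 * (E / α) ≤ s' := by rw [← mul_div_assoc]; exact hs
  have h1 := h.sum_holders_le hlam hα hE (by linarith) hss
  have h2 : ((Finset.univ.filter fun j => s' - 2 * E ≤ X j).card : ℝ) * (21 * (E / α)) ≤
      ∑ j, ((holders st.asg j).card : ℝ) := by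
    rw [← nsmul_eq_mul, ← Finset.sum_const]
    calc _ ≤ ∑ j ∈ Finset.univ.filter (fun j => s' - 2 * E ≤ X j),
          ((holders st.asg j).card : ℝ) := by
          refine Finset.sum_le_sum fun j hj => ?_
          have := h.card_holders_ge (Finset.mem_filter.1 hj).2
          linarith
      _ ≤ _ := Finset.sum_le_univ_sum_of_nonneg fun _ => Nat.cast_nonneg _
  set G : ℝ := ((Finset.univ.filter fun j => s' - 2 * E ≤ X j).card : ℝ)
  have h3 : lam * (G * (21 * (E / α))) ≤ optWelfare s v :=
    (mul_le_mul_of_nonneg_left h2 hlam0.le).trans h1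
  calc 21 * E * G = α / lam * (lam * (G * (21 * (E / α)))) := by field_simp
    _ ≤ _ := mul_le_mul_of_nonneg_left h3 (by positivity)

/-- If the algorithm has halted with few unmatched bidders, its output is nearly optimal. -/
theorem RoundInv.welfare_ge (hlam0 : 0 < lam) (hlam : ∀ i j, v i j ≠ 0 → lam ≤ v i j)
    (hv : ∀ i j, v i j ≤ 1) (hα : 0 < α) (hα1 : α < 1) (hE : 1 ≤ E)
    (hs : 24 * E / α ≤ s') (hss : (s : ℝ) = s' + (2 * E + 1)) (h : RoundInv α s' E v m st X q g)
    (hU : ((unmatchedSet st.asg).card : ℝ) ≤ α * optWelfare s v / (2 * lam) +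
      (4 * E + 1) * (Finset.univ.filter fun j => s' - 2 * E ≤ X j).card) :
    (1 - 4 * (α / lam)) * optWelfare s v ≤ welfare v (outputOf st) := by
  classical
  have hEα : E ≤ E / α := by rw [le_div_iff₀ hα]; nlinarith
  have hs' : 24 * (E / α) ≤ s' := by rw [← mul_div_assoc]; exact hs
  have h1 := h.sum_holders_le hlam hα hE (by linarith) hss
  have h2 := h.card_popular_le hlam0 hlam hα hα1 hE hs hss
  obtain ⟨ν, hν, hopt⟩ := exists_welfare_eq_optWelfare s v
  set O := optWelfare s v
  set G : ℝ := ((Finset.univ.filter fun j => s' - 2 * E ≤ X j).card : ℝ)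
  have hG0 : 0 ≤ G := Nat.cast_nonneg _
  have hp0 : ∀ j, 0 ≤ st.price j := fun j => by rw [h.goods.price j]; positivity
  have h3 := welfare_le_of_equilibrium (v := v) (α := α) (p := st.price) (μ := outputOf st) (ν := ν)
    (U := unmatchedSet st.asg) hp0 hv (fun i j hij => by
      have hi := outputOf_eq_some.1 hij
      have h4 := h.price_le hα (by linarith) hE hi
      have h5 := h.bidders.profit i j hi
      refine ⟨by linarith, fun j' => ?_⟩
      have h6 := h.bidders.favourite i j hi j'
      linarith) (fun i hi => by
      rcases outputOf_eq_none hi with h4 | h4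
      · exact Or.inl (by simp [unmatchedSet, h4])
      · exact Or.inr (h.bidders.dummy i h4)) hν
  simp only [usage_outputOf] at h3
  have h4 : ∑ j, st.price j * ((s : ℝ) - (holders st.asg j).card) ≤ 18 * E * G := by
    have hj : ∀ j, st.price j * ((s : ℝ) - (holders st.asg j).card) ≤
        if s' - 2 * E ≤ X j then 18 * E else 0 := by
      intro j
      by_cases hq : q j = 0
      · rw [h.goods.price j, hq]
        simp only [Nat.cast_zero, mul_zero, zero_mul]
        split_ifs <;> linarith
      · have hX := h.sub_le_of_pos hE (by linarith) hq
        rw [if_pos hX]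
        have hge := h.card_holders_ge hX
        have hpos : 0 < (holders st.asg j).card := by
          have : (0 : ℝ) < (holders st.asg j).card := by linarith
          exact_mod_cast this
        have hp := h.price_le_of_holder hv hα (by linarith) hE hpos
        calc st.price j * ((s : ℝ) - (holders st.asg j).card) ≤ st.price j * (6 * E) :=
              mul_le_mul_of_nonneg_left (by linarith) (hp0 j)
          _ ≤ 3 * (6 * E) := mul_le_mul_of_nonneg_right (by linarith) (by linarith)
          _ = 18 * E := by ring
    refine (Finset.sum_le_sum fun j _ => hj j).trans (le_of_eq ?_)
    rw [← Finset.sum_filter, Finset.sum_const, nsmul_eq_mul, mul_comm]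
  clear_value O G
  generalize ∑ j, ((holders st.asg j).card : ℝ) = H at h1 h3
  have h5 : 2 * α * H ≤ 2 * (α / lam * O) := by
    calc 2 * α * H = 2 * (α / lam * (lam * H)) := by field_simp
      _ ≤ _ := by gcongr
  have h6 : α * O / (2 * lam) = α / lam * O / 2 := by field_simp
  have h7 : (4 * E + 1) * G ≤ 5 * E * G := mul_le_mul_of_nonneg_right (by linarith) hG0
  rw [hopt] at h3
  have h8 : 0 ≤ E * G := mul_nonneg (by linarith) hG0
  nlinarith

theorem welfare_readRun_ge {η : Option (Fin k) → ℕ → ℝ} {tie : TieRule n k} (hn : 0 < n)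
    (hlam0 : 0 < lam) (hlam : ∀ i j, v i j ≠ 0 → lam ≤ v i j) (hv : ∀ i j, v i j ≤ 1)
    (hα : 0 < α) (hα1 : α < 1) (hE : 1 ≤ E) (hs : 24 * E / α ≤ s')
    (hss : (s : ℝ) = s' + (2 * E + 1)) (htie : tie.Valid)
    (hη : ∀ c t, t ≤ horizon n α → |noiseSum (η c) t| ≤ E)
    (hopt : 16 * lam * E ≤ α * optWelfare s v) (hθ : θ = α * optWelfare s v / (2 * lam) - 2 * E) :
    IsMatching s (outputOf (readRun α s' θ (counterReader η) tie v (rounds α))) ∧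
      (1 - 4 * (α / lam)) * optWelfare s v ≤
        welfare v (outputOf (readRun α s' θ (counterReader η) tie v (rounds α))) := by
  have hEα : E ≤ E / α := by rw [le_div_iff₀ hα]; nlinarith
  have hs' : 24 * (E / α) ≤ s' := by rw [← mul_div_assoc]; exact hs
  obtain ⟨m', X, q, g, h1, h2⟩ := exists_roundInv (θ := θ) (v := v) (s' := s') (m := rounds α) hn hα
    hE (by linarith) hη htie le_rfl
  set st := readRun α s' θ (counterReader η) tie v (rounds α)
  refine ⟨h1.isMatching hE (by linarith) hss, ?_⟩
  split_ifs at h2 with hh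
  · refine h1.welfare_ge hlam0 hlam hv hα hα1 hE hs hss (h2.trans ?_)
    rw [hθ]
    linarith
  · exfalso
    have h3 := h1.sum_holders_le hlam hα hE (by linarith) hss
    have h4 : ∑ j, (X j : ℝ) ≤ 5 / α * ∑ j, ((holders st.asg j).card : ℝ) := by
      rw [Finset.mul_sum]
      exact Finset.sum_le_sum fun j _ => h1.bids_le hv hα hα1 hs hE j
    set O := optWelfare s v
    have hO : 0 < O := by
      have : 0 < α * O := lt_of_lt_of_le (by positivity) hopt
      exact pos_of_mul_pos_right this hα.le
    have h5 : α * O / (4 * lam) ≤ θ - 2 * E := by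
      have : 4 * E ≤ α * O / (4 * lam) := by
        rw [le_div_iff₀ (by positivity)]; linarith
      have e : α * O / (2 * lam) = α * O / (4 * lam) + α * O / (4 * lam) := by
        field_simp; norm_num
      rw [hθ]; linarith
    have h6 : 24 / α ^ 2 ≤ (rounds α : ℝ) := Nat.le_ceil _
    have h7 : 24 / α ^ 2 * (α * O / (4 * lam)) ≤ ∑ j, (X j : ℝ) := by
      refine le_trans ?_ h2.2
      gcongr
    have h8 : 5 / α * ∑ j, ((holders st.asg j).card : ℝ) ≤ 5 / α * (O / lam) := by
      refine mul_le_mul_of_nonneg_left ?_ (by positivity)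
      rw [le_div_iff₀ hlam0]; linarith
    have h9 : 24 / α ^ 2 * (α * O / (4 * lam)) = 6 / α * (O / lam) := by
      field_simp; norm_num
    have h10 : 5 / α * (O / lam) < 6 / α * (O / lam) := by
      gcongr
      norm_num
    linarith

end

/-! ### Size of the error bound -/

/-- The base of the polylogarithmic factor. -/
def logSum (n k : ℕ) (α γ : ℝ) : ℝ :=
  1 + Real.log n + Real.log k + Real.log (1 / α) + Real.log (1 / γ)

section

variable {α ε γ : ℝ}

theorem log_one_div_nonneg {x : ℝ} (h : 0 < x) (h1 : x < 1) : 0 ≤ Real.log (1 / x) :=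
  Real.log_nonneg (by rw [le_div_iff₀ h]; linarith)

theorem one_le_logSum (hα : 0 < α) (hα1 : α < 1) (hγ : 0 < γ) (hγ1 : γ < 1) :
    1 ≤ logSum n k α γ := by
  have h1 := Real.log_natCast_nonneg n
  have h2 := Real.log_natCast_nonneg k
  have h3 := log_one_div_nonneg hα hα1
  have h4 := log_one_div_nonneg hγ hγ1
  unfold logSum
  linarith

theorem rounds_le (hα : 0 < α) (hα1 : α < 1) : (rounds α : ℝ) ≤ 25 / α ^ 2 := by
  have h1 := (Nat.ceil_lt_add_one (by positivity : (0 : ℝ) ≤ 24 / α ^ 2)).le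
  have h2 : 1 ≤ 1 / α ^ 2 := by
    rw [le_div_iff₀ (by positivity)]
    nlinarith
  calc (rounds α : ℝ) ≤ 24 / α ^ 2 + 1 := h1
    _ ≤ 24 / α ^ 2 + 1 / α ^ 2 := by linarith
    _ = _ := by ring

theorem logHorizon_le (hn : 0 < n) (hα : 0 < α) (hα1 : α < 1) (hγ : 0 < γ) (hγ1 : γ < 1) :
    logHorizon n α ≤ 8 * logSum n k α γ := by
  have hT := rounds_pos hα
  have hN : 0 < horizon n α := Nat.mul_pos hn hT
  have hL := one_le_logSum (n := n) (k := k) hα hα1 hγ hγ1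
  have h1 : 2 ^ ((horizon n α).size - 1) ≤ horizon n α :=
    Nat.lt_size.1 (Nat.sub_lt (Nat.size_pos.2 hN) one_pos)
  have h2 : (((horizon n α).size - 1 : ℕ) : ℝ) * Real.log 2 ≤ Real.log (horizon n α) := by
    rw [← Real.log_pow]
    exact Real.log_le_log (by positivity) (by exact_mod_cast h1)
  have h3 : Real.log (horizon n α) = Real.log n + Real.log (rounds α) := by
    unfold horizon
    rw [Nat.cast_mul, Real.log_mul]
    · exact_mod_cast hn.ne'
    · exact_mod_cast hT.ne'
  have h4 : Real.log (rounds α) ≤ 5 * Real.log 2 + 2 * Real.log (1 / α) := by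
    calc Real.log (rounds α) ≤ Real.log (2 ^ 5 * (1 / α) ^ 2) := by
          refine Real.log_le_log (by exact_mod_cast hT) ((rounds_le hα hα1).trans ?_)
          rw [div_pow, one_pow, mul_one_div]
          gcongr
          norm_num
      _ = _ := by
          rw [Real.log_mul (by positivity) (by positivity), Real.log_pow, Real.log_pow]
          norm_num
  have hlog2 := Real.log_two_gt_d9
  have hlog2' := Real.log_two_lt_d9
  have h5 : logHorizon n α = (((horizon n α).size - 1 : ℕ) : ℝ) + 1 := by
    unfold logHorizon
    rw [Nat.cast_sub (Nat.size_pos.2 hN)]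
    simp
  have h6 := Real.log_natCast_nonneg n
  have h7 := Real.log_natCast_nonneg k
  have h8 := log_one_div_nonneg hα hα1
  have h9 := log_one_div_nonneg hγ hγ1
  have h10 : Real.log (horizon n α) ≤ 7 / 2 * logSum n k α γ := by
    rw [h3]
    unfold logSum
    linarith
  rw [h5]
  nlinarith [Nat.cast_nonneg (α := ℝ) ((horizon n α).size - 1)]

theorem log_four_mul_div_le (hk : 0 < k) (hα : 0 < α) (hα1 : α < 1) (hγ : 0 < γ) (hγ1 : γ < 1) :
    Real.log (4 * k / γ) ≤ 2 * logSum n k α γ := by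
  have h6 := Real.log_natCast_nonneg n
  have h7 := Real.log_natCast_nonneg k
  have h8 := log_one_div_nonneg hα hα1
  have h9 := log_one_div_nonneg hγ hγ1
  have hk' : (0 : ℝ) < k := by exact_mod_cast hk
  have hlog2' := Real.log_two_lt_d9
  have : Real.log (4 * k / γ) = 2 * Real.log 2 + Real.log k + Real.log (1 / γ) := by
    rw [show 4 * (k : ℝ) / γ = 2 ^ 2 * k * (1 / γ) by ring, Real.log_mul (by positivity)
      (by positivity), Real.log_mul (by positivity) (by positivity), Real.log_pow]
    norm_num
  rw [this]
  unfold logSum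
  linarith

theorem errBound_le (hn : 0 < n) (hk : 0 < k) (hα : 0 < α) (hα1 : α < 1) (hε : 0 < ε) (hγ : 0 < γ)
    (hγ1 : γ < 1) : errBound n k α ε γ ≤ 153600 / (α ^ 2 * ε) * logSum n k α γ ^ 4 := by
  have hL := one_le_logSum (n := n) (k := k) hα hα1 hγ hγ1
  have hl := logHorizon_ge hn hα hα1
  have hl' := logHorizon_le (k := k) hn hα hα1 hγ hγ1
  have hlog := log_four_mul_div_le (n := n) hk hα hα1 hγ hγ1
  have hlog1 := one_lt_log_four_mul_div hk hγ hγ1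
  have hsqrt : Real.sqrt 2 ≤ 3 / 2 := by
    rw [Real.sqrt_le_left (by norm_num)]; norm_num
  have hinv : 1 / epsCounter α ε ≤ 50 / (α ^ 2 * ε) := by
    unfold epsCounter
    rw [one_div_div, div_le_div_iff₀ hε (by positivity)]
    have := rounds_le hα hα1
    rw [le_div_iff₀ (by positivity)] at this
    nlinarith
  have hpow : logHorizon n α ^ (5 / 2 : ℝ) ≤ (8 * logSum n k α γ) ^ 3 := by
    calc logHorizon n α ^ (5 / 2 : ℝ) ≤ logHorizon n α ^ ((3 : ℕ) : ℝ) :=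
          Real.rpow_le_rpow_of_exponent_le (by linarith) (by norm_num)
      _ = logHorizon n α ^ 3 := Real.rpow_natCast _ _
      _ ≤ _ := by gcongr
  have he := epsCounter_pos hα hε
  unfold errBound
  calc 2 * Real.sqrt 2 / epsCounter α ε * logHorizon n α ^ (5 / 2 : ℝ) * Real.log (4 * k / γ)
      = 2 * Real.sqrt 2 * (1 / epsCounter α ε) * logHorizon n α ^ (5 / 2 : ℝ) *
          Real.log (4 * k / γ) := by ring
    _ ≤ 2 * (3 / 2) * (50 / (α ^ 2 * ε)) * (8 * logSum n k α γ) ^ 3 * (2 * logSum n k α γ) := by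
        gcongr
    _ = _ := by ring

theorem one_le_errBound (hn : 0 < n) (hk : 0 < k) (hα : 0 < α) (hα1 : α < 1) (hε : 0 < ε)
    (hγ : 0 < γ) (hγ1 : γ < 1) (h : α ^ 2 * ε ≤ 1) : 1 ≤ errBound n k α ε γ := by
  refine le_trans ?_ (four_mul_sq_le_errBound hn hk hα hα1 hε hγ hγ1)
  have hl := logHorizon_ge hn hα hα1
  have hlog1 := one_lt_log_four_mul_div hk hγ hγ1
  have he := epsCounter_pos hα hε
  have he1 : epsCounter α ε ≤ 1 := by
    have hT : 24 / α ^ 2 ≤ (rounds α : ℝ) := Nat.le_ceil _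
    rw [div_le_iff₀ (by positivity)] at hT
    have hT0 : (0 : ℝ) < rounds α := by exact_mod_cast rounds_pos hα
    unfold epsCounter
    rw [div_le_one (by positivity)]
    have h1 : ε * α ^ 2 ≤ 2 * rounds α * α ^ 2 := by linarith
    exact le_of_mul_le_mul_right h1 (by positivity)
  rw [le_div_iff₀ he, one_mul]
  have : 1 ≤ 4 * logHorizon n α ^ 2 := by nlinarith
  nlinarith

end

theorem pos_of_optWelfare_pos {s : ℕ} {v : Fin n → Fin k → ℝ} (h : 0 < optWelfare s v) :
    0 < n ∧ 0 < k := by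
  obtain ⟨μ, -, hμ⟩ := exists_welfare_eq_optWelfare s v
  rw [← hμ] at h
  constructor
  · rcases Nat.eq_zero_or_pos n with rfl | hn
    · simp [welfare] at h
    · exact hn
  · rcases Nat.eq_zero_or_pos k with rfl | hk
    · have : ∀ i, μ i = none := fun i => Subsingleton.elim _ _
      simp [welfare, this] at h
    · exact hk

theorem output_accurate {s : ℕ} {α ε γ lam : ℝ} {tie : TieRule n k} {v : Fin n → Fin k → ℝ}
    (hα : 0 < α) (hα1 : α < 1) (hε : 0 < ε) (hγ : 0 < γ) (hγ1 : γ < 1) (hlam0 : 0 < lam)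
    (htie : tie.Valid) (hv : ∀ i j, v i j ∈ Set.Icc (0 : ℝ) 1)
    (hlam : ∀ i j, v i j ≠ 0 → lam ≤ v i j) (hαε : α ^ 2 * ε ≤ 1)
    (hs : 4147200 / (α ^ 3 * ε) * polylog 4 n k α γ ≤ (s : ℝ))
    (hopt : 4147200 * lam / (α ^ 3 * ε) * polylog 4 n k α γ ≤ optWelfare s v) :
    ENNReal.ofReal (1 - γ) ≤ tapeMeasure n k α ε
      {ω | IsMatching s (output n k s α ε γ lam (optWelfare s v) tie v ω) ∧
        (1 - 4 * (α / lam)) * optWelfare s v ≤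
          welfare v (output n k s α ε γ lam (optWelfare s v) tie v ω)} := by
  have hP : polylog 4 n k α γ = logSum n k α γ ^ 4 := rfl
  have hL := one_le_logSum (n := n) (k := k) hα hα1 hγ hγ1
  rw [hP] at hs hopt
  have hO : 0 < optWelfare s v := lt_of_lt_of_le (by positivity) hopt
  obtain ⟨hn, hk⟩ := pos_of_optWelfare_pos hO
  have hE := errBound_le hn hk hα hα1 hε hγ hγ1
  have hE1 := one_le_errBound hn hk hα hα1 hε hγ hγ1 hαε
  refine (one_sub_le_measure_noise hn hk hα hα1 hε hγ hγ1).trans (measure_mono fun ω hω => ?_)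
  set E := errBound n k α ε γ
  have hEα : 27 * (E / α) ≤ 4147200 / (α ^ 3 * ε) * logSum n k α γ ^ 4 := by
    calc 27 * (E / α) ≤ 27 * (153600 / (α ^ 2 * ε) * logSum n k α γ ^ 4 / α) := by gcongr
      _ = _ := by field_simp; norm_num
  have hEE : E ≤ E / α := by rw [le_div_iff₀ hα]; nlinarith
  have hres : reserved n k α ε γ = 2 * E + 1 := rfl
  change IsMatching s _ ∧ _ ≤ welfare v _
  rw [output_eq]
  refine welfare_readRun_ge hn hlam0 hlam (fun i j => (hv i j).2) hα hα1 hE1 ?_ ?_ htie hω ?_ rfl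
  · rw [hres, mul_div_assoc]
    linarith
  · rw [hres]; ring
  · have h1 : lam * (27 * (E / α)) ≤ optWelfare s v := by
      refine le_trans ?_ hopt
      rw [mul_comm (4147200 : ℝ) lam, mul_div_assoc, mul_assoc]
      gcongr
    have h2 : α * (lam * (27 * (E / α))) = 27 * lam * E := by field_simp
    have h3 : α * (lam * (27 * (E / α))) ≤ α * optWelfare s v := by gcongr
    have h4 : 0 ≤ lam * E := by positivity
    linarith

end PMatch

end

theorem mainTheorem9 :
    ∃ (A K : ℝ) (d : ℕ), 0 < A ∧ 0 < K ∧
      ∀ (n k s : ℕ) (α ε γ lam : ℝ) (tie : PMatch.TieRule n k),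
        0 < α → α < 1 → 0 < ε → 0 < γ → γ < 1 → 0 < lam → tie.Valid →
        -- joint differential privacy, for every public value `opt`
        (∀ opt : ℝ,
          PMatch.JointDP (PMatch.tapeMeasure n k α ε)
            {w : Fin k → ℝ | ∀ j, w j ∈ Set.Icc (0 : ℝ) 1}
            (PMatch.output n k s α ε γ lam opt tie) ε) ∧
        -- welfare, when `opt` is the weight of a maximum weight matching
        (∀ v : Fin n → Fin k → ℝ,
          (∀ i j, v i j ∈ Set.Icc (0 : ℝ) 1) →
          (∀ i j, v i j ≠ 0 → lam ≤ v i j) →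
          α ^ 2 * ε ≤ 1 →
          K / (α ^ 3 * ε) * PMatch.polylog d n k α γ ≤ (s : ℝ) →
          K * lam / (α ^ 3 * ε) * PMatch.polylog d n k α γ ≤ PMatch.optWelfare s v →
          ENNReal.ofReal (1 - γ) ≤
            PMatch.tapeMeasure n k α ε
              {ω | PMatch.IsMatching s
                    (PMatch.output n k s α ε γ lam (PMatch.optWelfare s v) tie v ω) ∧
                  (1 - A * (α / lam)) * PMatch.optWelfare s v ≤
                    PMatch.welfare v
                      (PMatch.output n k s α ε γ lam (PMatch.optWelfare s v) tie v ω)}) := by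
  refine ⟨4, 4147200, 4, by norm_num, by norm_num, ?_⟩
  intro n k s α ε γ lam tie hα hα1 hε hγ hγ1 hlam htie
  exact ⟨fun opt => PMatch.jointDP_output s γ lam opt tie hα hε _,
    fun v hv hvl hαε hs hopt =>
      PMatch.output_accurate hα hα1 hε hγ hγ1 hlam htie hv hvl hαε hs hopt⟩
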